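/- Let $n\ge 3$, $p\ge 1$, $\tilde c\in\{0,1,-1\}$, $c\in\mathbb{R}$, let $I\subset\mathbb{R}$ be a nonempty open interval, and let $\mathbb{Q}^m_{\tilde c}$ denote $\mathbb{R}^m$ if $\tilde c=0$, the unit sphere $\mathbb{S}^m\subset\mathbb{R}^{m+1}$ if $\tilde c=1$, and the half-space model $\mathbb{H}^m$ of hyperbolic space if $\tilde c=-1$. Let $\gamma:I\to\mathbb{Q}^{p+1}_{\tilde c}$ be a smooth curve parametrized by arc length $s$ whose first curvature $\kappa=\|\nabla_{\gamma'}\gamma'\|$ is nowhere zero. Define $f:I\times\mathbb{Q}^{n-1}_{-\tilde c}\to\mathbb{R}^{n+p}$ by - $f(s,u)=(\gamma(s),u)$ if $\tilde c=0$; - $f(s,z)=(z_1\gamma(s),z_2,\dots,z_{n-1})$ if $\tilde c=1$, where $\mathbb{H}^{n-1}=\{z\in\mathbb{R}^{n-1}: z_1>0\}$ has the metric $z_1^{-2}(dz_1^2+\dots+dz_{n-1}^2)$; - $f(s,y)=(\gamma_1(s),\dots,\gamma_p(s),\gamma_{p+1}(s)\,y)$ if $\tilde c=-1$, where $y\in\mathbb{S}^{n-1}\subset\mathbb{R}^n$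 and $\mathbb{H}^{p+1}=\{z\in\mathbb{R}^{p+1}: z_{p+1}>0\}$ has the metric $z_{p+1}^{-2}(dz_1^2+\dots+dz_{p+1}^2)$. Let $\langle\,,\rangle_f$ be the metric induced by $f$, $\alpha^f$ its second fundamental form, $\mathcal{H}^f$ its mean curvature vector and $\rho^2=\frac{n}{n-1}\left(\|\alpha^f\|^2-n\|\mathcal{H}^f\|^2\right)$. Then $f$ is an immersion without umbilical points, and its Moebius metric $\langle\,,\rangle^*=\rho^2\langle\,,\rangle_f$ is $$\langle\,,\rangle^*=\kappa^2\,(ds^2+\sigma_{-\tilde c}),$$ where $\sigma_{-\tilde c}$ is the canonical metric of $\mathbb{Q}^{n-1}_{-\tilde c}$. Moreover, $\langle\,,\rangle^*$ has constant sectional curvature $c$ if and only if, after a change of the arc length parameter $t=\pm s+s_0$ with a fixed sign and a fixed $s_0\in\mathbb{R}$, the function $\kappa$ is given on all of $I$ by one of the following. - If $\tilde c=0$: $\kappa=\frac1r$ for some constant $r>0$, and $c=0$; or $\kappa=\frac{1}{\sqrt{-c}\,t}$ with $t>0$, and $c<0$. - If $\tilde c=1$: $\kappa=\frac{1}{\sqrt{-c}\,\sin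 t}$ with $t\in(0,\pi)$, and $c<0$. - If $\tilde c=-1$: $\kappa=\frac{1}{\sqrt{c}\,\cosh t}$, and $c>0$; or $\kappa=\frac{1}{\sqrt{-c}\,\sinh t}$ with $t>0$, and $c<0$; or $\kappa=e^{t}$, and $c=0$. -/

import Mathlib

open scoped Manifold ContDiff RealInnerProductSpace

noncomputable section

namespace MoebiusGeom

/-! ## Riemannian geometry of a metric on a finite-dimensional vector space

A (local) metric on a vector space `E` is a field `G : E → E →L[ℝ] E →L[ℝ] ℝ` of symmetric,
positive definite bilinear forms. -/

section LocalMetric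

variable {E : Type*} [NormedAddCommGroup E] [NormedSpace ℝ E]

/-- The Christoffel symbols of the Levi-Civita connection of `G` at `u`: `Γ = christoffel G u v w` is
the vector with
`2 G(Γ, z) = (D_v G)(w, z) + (D_w G)(v, z) - (D_z G)(v, w)` for all `z`
(`(G u).inverse` raises the index). -/
def christoffel (G : E → E →L[ℝ] E →L[ℝ] ℝ) (u v w : E) : E :=
  (G u).inverse ((1 / 2 : ℝ) •
    (fderiv ℝ G u v w + fderiv ℝ G u w v - ((fderiv ℝ G u).flip v).flip w))

/-- The curvature tensor `R(v, w) z = ∇_v ∇_w z - ∇_w ∇_v z` of `G` at `u`, for the constant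
vector fields `v`, `w`, `z`. -/
def curvatureTensor (G : E → E →L[ℝ] E →L[ℝ] ℝ) (u v w z : E) : E :=
  fderiv ℝ (fun u' => christoffel G u' w z) u v - fderiv ℝ (fun u' => christoffel G u' v z) u w
    + christoffel G u v (christoffel G u w z) - christoffel G u w (christoffel G u v z)

/-- The sectional curvature of `G` at `u` along the plane spanned by `v` and `w`. -/
def localSectionalCurvature (G : E → E →L[ℝ] E →L[ℝ] ℝ) (u v w : E) : ℝ :=
  G u (curvatureTensor G u v w w) v / (G u v v * G u w w - (G u v w) ^ 2)

/-- The covariant acceleration `∇_{γ'} γ'` of a curve with respect to `G`. -/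
def covariantAcceleration (G : E → E →L[ℝ] E →L[ℝ] ℝ) (γ : ℝ → E) (s : ℝ) : E :=
  deriv (deriv γ) s + christoffel G (γ s) (deriv γ s) (deriv γ s)

end LocalMetric

/-! ## Metrics on manifolds and immersions into Euclidean space

All manifolds are without boundary. Everything is expressed through the preferred chart at a
point `x`; the tangent space at `x` is identified with the model space `E` through that same chart. -/

section Manifold

variable {E : Type*} [NormedAddCommGroup E] [NormedSpace ℝ E]
  {H : Type*} [TopologicalSpace H] (I : ModelWithCorners ℝ E H)
  {M : Type*} [TopologicalSpace M] [ChartedSpace H M]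

/-- The expression of a field of bilinear forms `g` in the preferred chart at `x₀`: the pull-back of
`g` under the inverse of this chart. -/
def chartMetric (g : ∀ x : M, TangentSpace I x →L[ℝ] TangentSpace I x →L[ℝ] ℝ) (x₀ : M) :
    E → E →L[ℝ] E →L[ℝ] ℝ := fun u =>
  let φ : E → M := (extChartAt I x₀).symm
  let D : E →L[ℝ] E := mfderiv 𝓘(ℝ, E) I φ u
  let b : E →L[ℝ] E →L[ℝ] ℝ := g (φ u)
  b.bilinearComp D D

/-- The sectional curvature of the metric `g` at `x` along the plane spanned by `v` and `w`. -/
def sectionalCurvature (g : ∀ x : M, TangentSpace I x →L[ℝ] TangentSpace I x →L[ℝ] ℝ) (x : M)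
    (v w : TangentSpace I x) : ℝ :=
  localSectionalCurvature (chartMetric I g x) (extChartAt I x x) v w

/-- The metric `g` has constant sectional curvature `c` on the open set `Ω`. -/
def HasConstantCurvatureOn (g : ∀ x : M, TangentSpace I x →L[ℝ] TangentSpace I x →L[ℝ] ℝ)
    (Ω : Set M) (c : ℝ) : Prop :=
  ∀ x ∈ Ω, ∀ v w : TangentSpace I x, LinearIndependent ℝ ![v, w] → sectionalCurvature I g x v w = c

variable {ι : Type*} [Fintype ι]

/-- The differential `f_*` of `f` at `x`. -/
def differential (f : M → EuclideanSpace ℝ ι) (x : M) :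
    TangentSpace I x →L[ℝ] EuclideanSpace ℝ ι :=
  mfderiv I 𝓘(ℝ, EuclideanSpace ℝ ι) f x

/-- `f` is a smooth immersion on the open set `Ω`. -/
def IsImmersionOn (f : M → EuclideanSpace ℝ ι) (Ω : Set M) : Prop :=
  ContMDiffOn I 𝓘(ℝ, EuclideanSpace ℝ ι) ∞ f Ω ∧
    ∀ x ∈ Ω, Function.Injective (differential I f x)

/-- The metric `⟨v, w⟩_f = ⟨f_* v, f_* w⟩` induced by `f`. -/
def inducedMetric (f : M → EuclideanSpace ℝ ι) (x : M) :
    TangentSpace I x →L[ℝ] TangentSpace I x →L[ℝ] ℝ :=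
  let D : E →L[ℝ] EuclideanSpace ℝ ι := differential I f x
  let b : EuclideanSpace ℝ ι →L[ℝ] EuclideanSpace ℝ ι →L[ℝ] ℝ := innerSL ℝ
  (b.bilinearComp D D : E →L[ℝ] E →L[ℝ] ℝ)

/-- The second fundamental form `α^f` of `f` at `x`: the component normal to `f_* T_x M` of the
second derivative of `f` in the preferred chart at `x`. -/
def secondFundamentalForm (f : M → EuclideanSpace ℝ ι) (x : M) :
    TangentSpace I x →L[ℝ] TangentSpace I x →L[ℝ] EuclideanSpace ℝ ι :=
  let F : E → EuclideanSpace ℝ ι := f ∘ (extChartAt I x).symm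
  let N : Submodule ℝ (EuclideanSpace ℝ ι) := (LinearMap.range (differential I f x).toLinearMap)ᗮ
  let α : E →L[ℝ] E →L[ℝ] EuclideanSpace ℝ ι :=
    (ContinuousLinearMap.compL ℝ E (EuclideanSpace ℝ ι) (EuclideanSpace ℝ ι) N.starProjection) ∘L
      fderiv ℝ (fderiv ℝ F) (extChartAt I x x)
  α

/-- The shape operator `A_ξ` of `f` at `x`, given by `⟨A_ξ v, w⟩_f = ⟨α^f(v, w), ξ⟩`. -/
def shapeOperator (f : M → EuclideanSpace ℝ ι) (x : M) (ξ : EuclideanSpace ℝ ι) :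
    TangentSpace I x →L[ℝ] TangentSpace I x :=
  let g : E →L[ℝ] E →L[ℝ] ℝ := inducedMetric I f x
  let α : E →L[ℝ] E →L[ℝ] EuclideanSpace ℝ ι := secondFundamentalForm I f x
  (g.inverse ∘L (ContinuousLinearMap.compL ℝ E (EuclideanSpace ℝ ι) ℝ (innerSL ℝ ξ) ∘L α) :
    E →L[ℝ] E)

/-- `‖α^f‖² = ∑_{i,j} ‖α^f(X_i, X_j)‖²` for an orthonormal basis `X_i` of `(T_x M, ⟨ , ⟩_f)`, written
as `∑_k tr (A_{ξ_k} ∘ A_{ξ_k})` for the standard orthonormal basis `ξ_k` of the ambient space. -/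
def normSqSecondFundamentalForm (f : M → EuclideanSpace ℝ ι) (x : M) : ℝ :=
  open Classical in
  ∑ k : ι, LinearMap.trace ℝ (TangentSpace I x)
    ((shapeOperator I f x (EuclideanSpace.single k 1) ∘L
      shapeOperator I f x (EuclideanSpace.single k 1)).toLinearMap)

/-- The mean curvature vector `ℋ^f = (1 / n) ∑_i α^f(X_i, X_i)` of `f` at `x`, `n = dim M`; its `k`-th
coordinate is `(1 / n) tr A_{ξ_k}`. -/
def meanCurvatureVector (f : M → EuclideanSpace ℝ ι) (x : M) : EuclideanSpace ℝ ι :=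
  open Classical in
  WithLp.toLp 2 fun k : ι => (1 / (Module.finrank ℝ E : ℝ)) *
    LinearMap.trace ℝ (TangentSpace I x)
      (shapeOperator I f x (EuclideanSpace.single k 1)).toLinearMap

/-- The function `ρ² = n / (n - 1) * (‖α^f‖² - n ‖ℋ^f‖²)`, `n = dim M`. -/
def rhoSq (f : M → EuclideanSpace ℝ ι) (x : M) : ℝ :=
  let n : ℝ := Module.finrank ℝ E
  n / (n - 1) * (normSqSecondFundamentalForm I f x - n * ‖meanCurvatureVector I f x‖ ^ 2)

/-- The Moebius metric `⟨ , ⟩^* = ρ² ⟨ , ⟩_f` determined by `f`. -/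
def moebiusMetric (f : M → EuclideanSpace ℝ ι) (x : M) :
    TangentSpace I x →L[ℝ] TangentSpace I x →L[ℝ] ℝ :=
  rhoSq I f x • inducedMetric I f x

/-- `f` has no umbilical points on `Ω`; `x` is umbilical if `α^f(v, w) = ⟨v, w⟩_f η` for some
normal vector `η`. -/
def IsUmbilicFreeOn (f : M → EuclideanSpace ℝ ι) (Ω : Set M) : Prop :=
  ∀ x ∈ Ω, ¬ ∃ η : EuclideanSpace ℝ ι, ∀ v w : TangentSpace I x,
    secondFundamentalForm I f x v w = inducedMetric I f x v w • η

end Manifold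

/-! ## Curves in space forms

Euclidean space, the unit sphere in Euclidean space, and the upper half-space. -/

/-- The hyperbolic metric `(dz_1² + ⋯ + dz_m²) / z_i²` of the half-space model `{z | 0 < z_i}`. -/
def hyperbolicMetric {m : ℕ} (i : Fin m) (z : EuclideanSpace ℝ (Fin m)) :
    EuclideanSpace ℝ (Fin m) →L[ℝ] EuclideanSpace ℝ (Fin m) →L[ℝ] ℝ :=
  (1 / z i ^ 2) • innerSL ℝ

/-- `γ` restricted to the interval `J` is a smooth curve in `ℝ^m` parametrized by arc length. -/
def IsUnitSpeedEuclidean {m : ℕ} (γ : ℝ → EuclideanSpace ℝ (Fin m)) (J : Set ℝ) : Prop :=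
  ContDiffOn ℝ ∞ γ J ∧ ∀ s ∈ J, ‖deriv γ s‖ = 1

/-- The first curvature `‖γ''‖` of a unit speed curve in `ℝ^m`. -/
def curvatureEuclidean {m : ℕ} (γ : ℝ → EuclideanSpace ℝ (Fin m)) (s : ℝ) : ℝ :=
  ‖deriv (deriv γ) s‖

/-- `γ` restricted to the interval `J` is a smooth curve in the unit sphere of `ℝ^m` parametrized by
arc length. -/
def IsUnitSpeedSphere {m : ℕ} (γ : ℝ → EuclideanSpace ℝ (Fin m)) (J : Set ℝ) : Prop :=
  ContDiffOn ℝ ∞ γ J ∧ (∀ s ∈ J, ‖γ s‖ = 1) ∧ ∀ s ∈ J, ‖deriv γ s‖ = 1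

/-- The first curvature of a unit speed curve in the unit sphere: the length of `∇_{γ'} γ'`, the
component of `γ''` tangent to the sphere. -/
def curvatureSphere {m : ℕ} (γ : ℝ → EuclideanSpace ℝ (Fin m)) (s : ℝ) : ℝ :=
  ‖deriv (deriv γ) s - ⟪deriv (deriv γ) s, γ s⟫ • γ s‖

/-- `γ` restricted to the interval `J` is a smooth curve in the half-space model `{z | 0 < z_i}` of
hyperbolic space parametrized by arc length. -/
def IsUnitSpeedHyperbolic {m : ℕ} (i : Fin m) (γ : ℝ → EuclideanSpace ℝ (Fin m)) (J : Set ℝ) :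
    Prop :=
  ContDiffOn ℝ ∞ γ J ∧ (∀ s ∈ J, 0 < γ s i) ∧
    ∀ s ∈ J, hyperbolicMetric i (γ s) (deriv γ s) (deriv γ s) = 1

/-- The first curvature of a unit speed curve in the half-space model: the hyperbolic length of
`∇_{γ'} γ'`. -/
def curvatureHyperbolic {m : ℕ} (i : Fin m) (γ : ℝ → EuclideanSpace ℝ (Fin m)) (s : ℝ) : ℝ :=
  let a := covariantAcceleration (hyperbolicMetric i) γ s
  √(hyperbolicMetric i (γ s) a a)

/-- After a change `t = ± s + s₀` of the arc length parameter, `κ` is given on `J` by the function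
`k`, whose domain is `D`. -/
def IsUpToArcLength (κ : ℝ → ℝ) (J : Set ℝ) (k : ℝ → ℝ) (D : Set ℝ) : Prop :=
  ∃ ε s₀ : ℝ, (ε = 1 ∨ ε = -1) ∧ ∀ s ∈ J, ε * s + s₀ ∈ D ∧ κ s = k (ε * s + s₀)

/-! ## The three types of immersions over a curve

`ℝ^a × ℝ^b` is written as `EuclideanSpace ℝ (Fin a ⊕ Fin b)`. -/

/-- The point `(x, y)` of `ℝ^a × ℝ^b = ℝ^{a + b}`. -/
def euclideanPair {a b : ℕ} (x : Fin a → ℝ) (y : Fin b → ℝ) : EuclideanSpace ℝ (Fin a ⊕ Fin b) :=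
  WithLp.toLp 2 (Sum.elim x y)

/-- The cylinder `f(s, u) = (γ(s), u)` over a curve `γ` in `ℝ^{p + 1}`. -/
def cylinder {a b : ℕ} (γ : ℝ → EuclideanSpace ℝ (Fin a)) (x : ℝ × EuclideanSpace ℝ (Fin b)) :
    EuclideanSpace ℝ (Fin a ⊕ Fin b) :=
  euclideanPair (γ x.1) x.2

/-- The generalized cone `f(s, z) = (z_1 γ(s), z_2, …, z_{b + 1})` over a curve `γ` in the unit sphere
of `ℝ^a`. -/
def generalizedCone {a b : ℕ} (γ : ℝ → EuclideanSpace ℝ (Fin a))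
    (x : ℝ × EuclideanSpace ℝ (Fin (b + 1))) : EuclideanSpace ℝ (Fin a ⊕ Fin b) :=
  euclideanPair (x.2 0 • γ x.1) fun j => x.2 j.succ

/-- The rotational submanifold `f(s, y) = (γ_1(s), …, γ_a(s), γ_{a + 1}(s) y)` over a curve `γ` in the
half-space `{z | 0 < z_{a + 1}}` of `ℝ^{a + 1}`, with `y` in the unit sphere of `ℝ^b`. -/
def rotational {a b : ℕ} (γ : ℝ → EuclideanSpace ℝ (Fin (a + 1)))
    (x : ℝ × Metric.sphere (0 : EuclideanSpace ℝ (Fin b)) 1) :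
    EuclideanSpace ℝ (Fin a ⊕ Fin b) :=
  euclideanPair (fun i => γ x.1 i.castSucc)
    (γ x.1 (Fin.last a) • (x.2 : EuclideanSpace ℝ (Fin b)))

/-- The canonical metric of the unit sphere of `ℝ^{b + 1}`, induced by the inclusion. -/
def sphereMetric {b : ℕ} (y : Metric.sphere (0 : EuclideanSpace ℝ (Fin (b + 1))) 1) :
    TangentSpace (𝓡 b) y →L[ℝ] TangentSpace (𝓡 b) y →L[ℝ] ℝ :=
  inducedMetric (𝓡 b)
    (fun y' : Metric.sphere (0 : EuclideanSpace ℝ (Fin (b + 1))) 1 =>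
      (y' : EuclideanSpace ℝ (Fin (b + 1)))) y

end MoebiusGeom

end

noncomputable section

namespace MoebiusGeom

/-! ## Linear algebra: inverse of a metric, second fundamental form and `ρ²` at a point -/

section LinearAlgebra

variable {E : Type*} [NormedAddCommGroup E] [NormedSpace ℝ E] [FiniteDimensional ℝ E]

theorem inverse_apply_of_injective {A : E →L[ℝ] E →L[ℝ] ℝ} (hA : Function.Injective A) (v : E) :
    A.inverse (A v) = v := by
  have hfin : Module.finrank ℝ E = Module.finrank ℝ (E →L[ℝ] ℝ) := by
    rw [← (LinearMap.toContinuousLinearMap (𝕜 := ℝ) (E := E) (F' := ℝ)).finrank_eq]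
    exact Subspace.dual_finrank_eq.symm
  let e : E ≃L[ℝ] (E →L[ℝ] ℝ) :=
    (LinearMap.linearEquivOfInjective A.toLinearMap hA hfin).toContinuousLinearEquiv
  have he : (e : E →L[ℝ] E →L[ℝ] ℝ) = A := by
    ext1 v
    exact LinearMap.linearEquivOfInjective_apply (f := A.toLinearMap) hA hfin v
  rw [← he, ContinuousLinearMap.inverse_equiv]
  exact e.symm_apply_apply v

omit [FiniteDimensional ℝ E] in
theorem injective_of_apply_self_ne_zero {A : E →L[ℝ] E →L[ℝ] ℝ} (hA : ∀ v, v ≠ 0 → A v v ≠ 0) :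
    Function.Injective A := by
  refine (injective_iff_map_eq_zero A).2 fun v hv => ?_
  by_contra h
  exact hA v h (by simp [hv])

theorem christoffel_eq_of {G : E → E →L[ℝ] E →L[ℝ] ℝ} {u v w Γ : E}
    (hG : Function.Injective (G u))
    (h : ∀ z, fderiv ℝ G u v w z + fderiv ℝ G u w v z - fderiv ℝ G u z v w = 2 * G u Γ z) :
    christoffel G u v w = Γ := by
  have : (1 / 2 : ℝ) • (fderiv ℝ G u v w + fderiv ℝ G u w v - ((fderiv ℝ G u).flip v).flip w)
      = G u Γ := by
    ext z
    have := h z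
    simp only [smul_apply, sub_apply,
      add_apply, ContinuousLinearMap.flip_apply, smul_eq_mul]
    linarith
  rw [christoffel, this, inverse_apply_of_injective hG]

end LinearAlgebra

section Pointwise

variable {E : Type*} [NormedAddCommGroup E] [NormedSpace ℝ E] [FiniteDimensional ℝ E]
  {H : Type*} [TopologicalSpace H] (I : ModelWithCorners ℝ E H)
  {M : Type*} [TopologicalSpace M] [ChartedSpace H M]
  {ι : Type*} [Fintype ι] {f : M → EuclideanSpace ℝ ι} {x : M}

/-- The induced metric as a form on the model space. -/
def inducedForm (f : M → EuclideanSpace ℝ ι) (x : M) : E →L[ℝ] E →L[ℝ] ℝ := inducedMetric I f x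

/-- The second fundamental form as a form on the model space. -/
def normalForm (f : M → EuclideanSpace ℝ ι) (x : M) : E →L[ℝ] E →L[ℝ] EuclideanSpace ℝ ι :=
  secondFundamentalForm I f x

/-- The shape operator as an endomorphism of the model space. -/
def shapeEnd (f : M → EuclideanSpace ℝ ι) (x : M) (ζ : EuclideanSpace ℝ ι) : E →L[ℝ] E :=
  shapeOperator I f x ζ

/-- At `x` the metric induced by `f` is positive definite, `e` is the vector dual to `θ`, and the
second fundamental form is `⟨ , ⟩_f η + θ² ξ`. -/
structure IsQuasiUmbilicAt (f : M → EuclideanSpace ℝ ι) (x : M) (θ : E →L[ℝ] ℝ) (e : E)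
    (η ξ : EuclideanSpace ℝ ι) : Prop where
  ne_zero : ∀ v : E, v ≠ 0 → inducedForm I f x v v ≠ 0
  dual : ∀ v : E, inducedForm I f x e v = θ v
  form : ∀ v w : E, normalForm I f x v w = inducedForm I f x v w • η + (θ v * θ w) • ξ

namespace IsQuasiUmbilicAt

variable {I} {θ : E →L[ℝ] ℝ} {e : E} {η ξ : EuclideanSpace ℝ ι}

theorem shapeEnd_eq (h : IsQuasiUmbilicAt I f x θ e η ξ) (ζ : EuclideanSpace ℝ ι) :
    shapeEnd I f x ζ = ⟪ζ, η⟫ • ContinuousLinearMap.id ℝ E + ⟪ζ, ξ⟫ • θ.smulRight e := by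
  ext v
  have key : (ContinuousLinearMap.compL ℝ E (EuclideanSpace ℝ ι) ℝ (innerSL ℝ ζ))
      (normalForm I f x v) = inducedForm I f x (⟪ζ, η⟫ • v + ⟪ζ, ξ⟫ • θ v • e) := by
    ext w
    simp only [ContinuousLinearMap.compL_apply, ContinuousLinearMap.comp_apply,
      innerSL_apply_apply, h.form, map_add, map_smul,
      add_apply, smul_apply, h.dual, smul_eq_mul]
    ring
  have := inverse_apply_of_injective (injective_of_apply_self_ne_zero h.ne_zero)
    (⟪ζ, η⟫ • v + ⟪ζ, ξ⟫ • θ v • e)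
  rw [← key] at this
  exact this

theorem trace_shapeOperator (h : IsQuasiUmbilicAt I f x θ e η ξ) (ζ : EuclideanSpace ℝ ι) :
    LinearMap.trace ℝ (TangentSpace I x) (shapeOperator I f x ζ).toLinearMap =
      Module.finrank ℝ E * ⟪ζ, η⟫ + θ e * ⟪ζ, ξ⟫ := by
  have h1 : (shapeEnd I f x ζ).toLinearMap =
      ⟪ζ, η⟫ • LinearMap.id + ⟪ζ, ξ⟫ • θ.toLinearMap.smulRight e := by
    rw [h.shapeEnd_eq]; rfl
  have h2 : LinearMap.trace ℝ E (shapeEnd I f x ζ).toLinearMap =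
      Module.finrank ℝ E * ⟪ζ, η⟫ + θ e * ⟪ζ, ξ⟫ := by
    rw [h1, map_add, map_smul, map_smul, LinearMap.trace_id, LinearMap.trace_smulRight]
    simp only [smul_eq_mul, ContinuousLinearMap.coe_coe]
    ring
  exact h2

theorem trace_shapeOperator_sq (h : IsQuasiUmbilicAt I f x θ e η ξ) (ζ : EuclideanSpace ℝ ι) :
    LinearMap.trace ℝ (TangentSpace I x)
      (shapeOperator I f x ζ ∘L shapeOperator I f x ζ).toLinearMap =
      Module.finrank ℝ E * ⟪ζ, η⟫ ^ 2 + 2 * θ e * (⟪ζ, η⟫ * ⟪ζ, ξ⟫) + θ e ^ 2 * ⟪ζ, ξ⟫ ^ 2 := by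
  have h1 : (shapeEnd I f x ζ ∘L shapeEnd I f x ζ).toLinearMap =
      (⟪ζ, η⟫ ^ 2) • LinearMap.id +
        (2 * ⟪ζ, η⟫ * ⟪ζ, ξ⟫ + θ e * ⟪ζ, ξ⟫ ^ 2) • θ.toLinearMap.smulRight e := by
    rw [h.shapeEnd_eq]
    ext v
    simp only [ContinuousLinearMap.comp_apply, ContinuousLinearMap.coe_coe,
      add_apply, smul_apply, ContinuousLinearMap.id_apply,
      ContinuousLinearMap.smulRight_apply, LinearMap.add_apply, LinearMap.smul_apply,
      LinearMap.id_apply, LinearMap.smulRight_apply, map_add, map_smul]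
    module
  have h2 : LinearMap.trace ℝ E (shapeEnd I f x ζ ∘L shapeEnd I f x ζ).toLinearMap =
      Module.finrank ℝ E * ⟪ζ, η⟫ ^ 2 + 2 * θ e * (⟪ζ, η⟫ * ⟪ζ, ξ⟫) + θ e ^ 2 * ⟪ζ, ξ⟫ ^ 2 := by
    rw [h1, map_add, map_smul, map_smul, LinearMap.trace_id, LinearMap.trace_smulRight]
    simp only [smul_eq_mul, ContinuousLinearMap.coe_coe]
    ring
  exact h2

theorem rhoSq_eq (h : IsQuasiUmbilicAt I f x θ e η ξ) (hn : 2 ≤ Module.finrank ℝ E) :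
    rhoSq I f x = θ e ^ 2 * ‖ξ‖ ^ 2 := by
  have hn' : (2 : ℝ) ≤ Module.finrank ℝ E := by exact_mod_cast hn
  set n : ℝ := (Module.finrank ℝ E : ℝ) with hndef
  have hH : ‖meanCurvatureVector I f x‖ ^ 2 =
      ∑ k, ((1 / n) * (n * η k + θ e * ξ k)) ^ 2 := by
    rw [EuclideanSpace.norm_sq_eq]
    refine Finset.sum_congr rfl fun k _ => ?_
    simp only [meanCurvatureVector, h.trace_shapeOperator, EuclideanSpace.inner_single_left,
      map_one, one_mul, Real.norm_eq_abs, sq_abs, hndef]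
  have hA : normSqSecondFundamentalForm I f x =
      ∑ k, (n * η k ^ 2 + 2 * θ e * (η k * ξ k) + θ e ^ 2 * ξ k ^ 2) := by
    simp only [normSqSecondFundamentalForm, h.trace_shapeOperator_sq,
      EuclideanSpace.inner_single_left, map_one, one_mul, hndef]
  have hξ : ‖ξ‖ ^ 2 = ∑ k, ξ k ^ 2 := by
    rw [EuclideanSpace.norm_sq_eq]
    simp only [Real.norm_eq_abs, sq_abs]
  have : rhoSq I f x = n / (n - 1) * (normSqSecondFundamentalForm I f x -
    n * ‖meanCurvatureVector I f x‖ ^ 2) := rfl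
  rw [this, hH, hA, hξ, Finset.mul_sum, ← Finset.sum_sub_distrib, Finset.mul_sum, Finset.mul_sum]
  refine Finset.sum_congr rfl fun k _ => ?_
  have h1 : n ≠ 0 := by linarith
  have h2 : n - 1 ≠ 0 := by linarith
  field_simp
  ring

omit [FiniteDimensional ℝ E] in
theorem not_umbilic (h : IsQuasiUmbilicAt I f x θ e η ξ) {v : E} (hv : v ≠ 0) (hθv : θ v = 0)
    (he : θ e ≠ 0) (hξ : ξ ≠ 0) :
    ¬ ∃ η' : EuclideanSpace ℝ ι, ∀ v w : TangentSpace I x,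
      secondFundamentalForm I f x v w = inducedMetric I f x v w • η' := by
  rintro ⟨η', h'⟩
  have key : ∀ v w : E, inducedForm I f x v w • η' =
      inducedForm I f x v w • η + (θ v * θ w) • ξ :=
    fun v w => (h' v w).symm.trans (h.form v w)
  have h1 := key v v
  rw [hθv, zero_mul, zero_smul, add_zero] at h1
  have h2 := smul_right_injective _ (h.ne_zero v hv) h1
  have h3 := key e e
  rw [h2, left_eq_add] at h3
  exact (smul_ne_zero (mul_ne_zero he he) hξ) h3

end IsQuasiUmbilicAt

end Pointwise

/-! ## Curvature of conformally warped products `K(s) (ds² + L(u) |du|²)` -/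

section Congruence

variable {E : Type*} [NormedAddCommGroup E] [NormedSpace ℝ E] {G G' : E → E →L[ℝ] E →L[ℝ] ℝ} {x : E}

theorem christoffel_congr (h : G =ᶠ[nhds x] G') (v w : E) :
    christoffel G x v w = christoffel G' x v w := by
  simp only [christoffel, h.fderiv_eq, h.eq_of_nhds]

theorem localSectionalCurvature_congr (h : G =ᶠ[nhds x] G') (v w : E) :
    localSectionalCurvature G x v w = localSectionalCurvature G' x v w := by
  have hc : ∀ a b, (fun y => christoffel G y a b) =ᶠ[nhds x] fun y => christoffel G' y a b :=
    fun a b => h.eventuallyEq_nhds.mono fun y hy => christoffel_congr hy a b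
  simp only [localSectionalCurvature, curvatureTensor, (hc _ _).fderiv_eq, (hc _ _).eq_of_nhds,
    h.eq_of_nhds]

end Congruence

theorem hasFDerivAt_smul_add_smul {E F : Type*} [NormedAddCommGroup E] [NormedSpace ℝ E]
    [NormedAddCommGroup F] [NormedSpace ℝ F] {f g : E → ℝ} {f' g' : E →L[ℝ] ℝ} {x : E}
    (hf : HasFDerivAt f f' x) (hg : HasFDerivAt g g' x) (a b : F) :
    HasFDerivAt (fun y => f y • (a + g y • b))
      (f x • g'.smulRight b + f'.smulRight (a + g x • b)) x :=
  hf.fun_smul ((hg.smul_const b).const_add a)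

section Warped

variable {V : Type*} [NormedAddCommGroup V] [InnerProductSpace ℝ V]

theorem hasFDerivAt_comp_fst {W : Type*} [NormedAddCommGroup W] [NormedSpace ℝ W] {A : ℝ → W}
    {a : W} {x : ℝ × V} (h : HasDerivAt A a x.1) :
    HasFDerivAt (fun y : ℝ × V => A y.1) ((ContinuousLinearMap.fst ℝ ℝ V).smulRight a) x := by
  have e : (ContinuousLinearMap.fst ℝ ℝ V).smulRight a =
      (ContinuousLinearMap.toSpanSingleton ℝ a).comp (ContinuousLinearMap.fst ℝ ℝ V) := by
    ext v <;> simp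
  rw [e]
  exact h.hasFDerivAt.comp x hasFDerivAt_fst

theorem hasFDerivAt_comp_snd {W : Type*} [NormedAddCommGroup W] [NormedSpace ℝ W] {B : V → W}
    {b : V →L[ℝ] W} {x : ℝ × V} (h : HasFDerivAt B b x.2) :
    HasFDerivAt (fun y : ℝ × V => B y.2) (b.comp (ContinuousLinearMap.snd ℝ ℝ V)) x :=
  h.comp x hasFDerivAt_snd

/-- The form `K(s) (ds² + L(u) |du|²)` in terms of projections `s = π₁ x` and `u = π₂ x`. -/
def warpedForm {E : Type*} [NormedAddCommGroup E] [NormedSpace ℝ E] (π₁ : E →L[ℝ] ℝ)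
    (π₂ : E →L[ℝ] V) (K : ℝ → ℝ) (L : V → ℝ) (x : E) : E →L[ℝ] E →L[ℝ] ℝ :=
  K (π₁ x) • ((innerSL ℝ : ℝ →L[ℝ] ℝ →L[ℝ] ℝ).bilinearComp π₁ π₁ +
    L (π₂ x) • (innerSL ℝ : V →L[ℝ] V →L[ℝ] ℝ).bilinearComp π₂ π₂)

theorem warpedForm_apply {E : Type*} [NormedAddCommGroup E] [NormedSpace ℝ E] (π₁ : E →L[ℝ] ℝ)
    (π₂ : E →L[ℝ] V) (K : ℝ → ℝ) (L : V → ℝ) (x v w : E) :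
    warpedForm π₁ π₂ K L x v w = K (π₁ x) * (π₁ v * π₁ w + L (π₂ x) * ⟪π₂ v, π₂ w⟫) := by
  simp [warpedForm]
  ring

theorem fderiv_warpedForm {E : Type*} [NormedAddCommGroup E] [NormedSpace ℝ E] (π₁ : E →L[ℝ] ℝ)
    (π₂ : E →L[ℝ] V) {K : ℝ → ℝ} {L : V → ℝ} {x : E} {p : ℝ} {q : V}
    (hK : HasDerivAt K (2 * p * K (π₁ x)) (π₁ x))
    (hL : HasFDerivAt L ((2 * L (π₂ x)) • innerSL ℝ q) (π₂ x)) (v w z : E) :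
    fderiv ℝ (warpedForm π₁ π₂ K L) x v w z =
      2 * p * K (π₁ x) * π₁ v * (π₁ w * π₁ z + L (π₂ x) * ⟪π₂ w, π₂ z⟫)
      + K (π₁ x) * (2 * L (π₂ x) * ⟪q, π₂ v⟫ * ⟪π₂ w, π₂ z⟫) := by
  have h : HasFDerivAt (warpedForm π₁ π₂ K L) _ x :=
    hasFDerivAt_smul_add_smul (hK.hasFDerivAt.comp x π₁.hasFDerivAt) (hL.comp x π₂.hasFDerivAt)
      ((innerSL ℝ : ℝ →L[ℝ] ℝ →L[ℝ] ℝ).bilinearComp π₁ π₁)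
      ((innerSL ℝ : V →L[ℝ] V →L[ℝ] ℝ).bilinearComp π₂ π₂)
  rw [h.fderiv]
  simp
  ring

/-- The metric `K(s) (ds² + L(u) |du|²)` on `ℝ × V`. -/
def warpedMetric (K : ℝ → ℝ) (L : V → ℝ) (x : ℝ × V) : (ℝ × V) →L[ℝ] (ℝ × V) →L[ℝ] ℝ :=
  warpedForm (ContinuousLinearMap.fst ℝ ℝ V) (ContinuousLinearMap.snd ℝ ℝ V) K L x

theorem warpedMetric_apply (K : ℝ → ℝ) (L : V → ℝ) (x v w : ℝ × V) :
    warpedMetric K L x v w = K x.1 * (v.1 * w.1 + L x.2 * ⟪v.2, w.2⟫) :=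
  warpedForm_apply _ _ _ _ _ _ _

theorem warpedMetric_apply_self_pos {K : ℝ → ℝ} {L : V → ℝ} {x : ℝ × V} (hK : 0 < K x.1)
    (hL : 0 < L x.2) {v : ℝ × V} (hv : v ≠ 0) : 0 < warpedMetric K L x v v := by
  rw [warpedMetric_apply]
  refine mul_pos hK ?_
  rw [real_inner_self_eq_norm_sq]
  by_cases h : v.1 = 0
  · have : v.2 ≠ 0 := fun h2 => hv (Prod.ext h h2)
    rw [h]
    have := norm_pos_iff.2 this
    positivity
  · have := mul_self_pos.2 h
    positivity

theorem fderiv_warpedMetric {K : ℝ → ℝ} {L : V → ℝ} {x : ℝ × V} {p : ℝ} {q : V}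
    (hK : HasDerivAt K (2 * p * K x.1) x.1)
    (hL : HasFDerivAt L ((2 * L x.2) • innerSL ℝ q) x.2) (v w z : ℝ × V) :
    fderiv ℝ (warpedMetric K L) x v w z = 2 * p * K x.1 * v.1 * (w.1 * z.1 + L x.2 * ⟪w.2, z.2⟫)
      + K x.1 * (2 * L x.2 * ⟪q, v.2⟫ * ⟪w.2, z.2⟫) :=
  fderiv_warpedForm (ContinuousLinearMap.fst ℝ ℝ V) (ContinuousLinearMap.snd ℝ ℝ V) hK hL v w z

/-- The Christoffel symbols of `K(s) (ds² + L(u) |du|²)` when `K' = 2 p K` and `∇L = 2 L q`. -/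
def warpedChristoffel (p l : ℝ) (q : V) (v w : ℝ × V) : ℝ × V :=
  (p * (v.1 * w.1 - l * ⟪v.2, w.2⟫),
    (p * v.1 + ⟪q, v.2⟫) • w.2 + (p * w.1 + ⟪q, w.2⟫) • v.2 - ⟪v.2, w.2⟫ • q)

theorem christoffel_warpedMetric [FiniteDimensional ℝ V] {K : ℝ → ℝ} {L : V → ℝ} {x : ℝ × V}
    {p : ℝ} {q : V} (hK0 : 0 < K x.1) (hL0 : 0 < L x.2)
    (hK : HasDerivAt K (2 * p * K x.1) x.1)
    (hL : HasFDerivAt L ((2 * L x.2) • innerSL ℝ q) x.2) (v w : ℝ × V) :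
    christoffel (warpedMetric K L) x v w = warpedChristoffel p (L x.2) q v w := by
  refine christoffel_eq_of (injective_of_apply_self_ne_zero fun v hv =>
    (warpedMetric_apply_self_pos hK0 hL0 hv).ne') fun z => ?_
  simp only [fderiv_warpedMetric hK hL, warpedMetric_apply, warpedChristoffel, inner_add_left,
    inner_sub_left, inner_smul_left, RCLike.conj_to_real]
  ring

theorem fderiv_warpedChristoffel {P : ℝ → ℝ} {L : V → ℝ} {q : V → V} {x : ℝ × V} {p' k : ℝ}
    (hP : HasDerivAt P p' x.1)
    (hL : HasFDerivAt L ((2 * L x.2) • innerSL ℝ (q x.2)) x.2)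
    (hq : HasFDerivAt q ((innerSL ℝ (q x.2)).smulRight (q x.2) -
      ((⟪q x.2, q x.2⟫ + k * L x.2) / 2) • ContinuousLinearMap.id ℝ V) x.2) (v w z : ℝ × V) :
    fderiv ℝ (fun y => warpedChristoffel (P y.1) (L y.2) (q y.2) w z) x v =
      (p' * v.1 * (w.1 * z.1 - L x.2 * ⟪w.2, z.2⟫) -
          P x.1 * (2 * L x.2 * ⟪q x.2, v.2⟫ * ⟪w.2, z.2⟫),
        (p' * v.1 * w.1 + (⟪q x.2, v.2⟫ * ⟪q x.2, w.2⟫ -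
          (⟪q x.2, q x.2⟫ + k * L x.2) / 2 * ⟪v.2, w.2⟫)) • z.2 +
        (p' * v.1 * z.1 + (⟪q x.2, v.2⟫ * ⟪q x.2, z.2⟫ -
          (⟪q x.2, q x.2⟫ + k * L x.2) / 2 * ⟪v.2, z.2⟫)) • w.2 -
        ⟪w.2, z.2⟫ • (⟪q x.2, v.2⟫ • q x.2 - ((⟪q x.2, q x.2⟫ + k * L x.2) / 2) • v.2)) := by
  have hP1 := hasFDerivAt_comp_fst (V := V) hP
  have hL1 := hasFDerivAt_comp_snd (x := x) hL
  have hq1 := hasFDerivAt_comp_snd (x := x) hq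
  have hqi : ∀ a : V, HasFDerivAt (fun y : ℝ × V => ⟪q y.2, a⟫) _ x := fun a =>
    hq1.inner ℝ (hasFDerivAt_const a x)
  have h1 := hP1.mul ((hL1.mul_const ⟪w.2, z.2⟫).const_sub (w.1 * z.1))
  have h2 := ((((hP1.mul_const w.1).add (hqi w.2)).smul_const z.2).add
    (((hP1.mul_const z.1).add (hqi z.2)).smul_const w.2)).sub (hq1.const_smul ⟪w.2, z.2⟫)
  have h : HasFDerivAt (fun y => warpedChristoffel (P y.1) (L y.2) (q y.2) w z) _ x := h1.prodMk h2
  rw [h.fderiv]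
  ext
  · simp
    ring
  · simp [inner_sub_left, inner_smul_left]
    module

theorem localSectionalCurvature_warpedMetric [FiniteDimensional ℝ V] {K P : ℝ → ℝ} {L : V → ℝ}
    {q : V → V} {x : ℝ × V} {p' k : ℝ} (hK0 : ∀ᶠ s in nhds x.1, 0 < K s)
    (hL0 : ∀ᶠ u in nhds x.2, 0 < L u)
    (hK : ∀ᶠ s in nhds x.1, HasDerivAt K (2 * P s * K s) s) (hP : HasDerivAt P p' x.1)
    (hL : ∀ᶠ u in nhds x.2, HasFDerivAt L ((2 * L u) • innerSL ℝ (q u)) u)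
    (hq : HasFDerivAt q ((innerSL ℝ (q x.2)).smulRight (q x.2) -
      ((⟪q x.2, q x.2⟫ + k * L x.2) / 2) • ContinuousLinearMap.id ℝ V) x.2) (v w : ℝ × V) :
    localSectionalCurvature (warpedMetric K L) x v w =
      K x.1 * (-p' * (L x.2 * (v.1 ^ 2 * ⟪w.2, w.2⟫ + w.1 ^ 2 * ⟪v.2, v.2⟫ -
        2 * v.1 * w.1 * ⟪v.2, w.2⟫)) + (k - P x.1 ^ 2) * (L x.2 ^ 2 *
        (⟪v.2, v.2⟫ * ⟪w.2, w.2⟫ - ⟪v.2, w.2⟫ ^ 2))) /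
      (warpedMetric K L x v v * warpedMetric K L x w w - warpedMetric K L x v w ^ 2) := by
  have hev : ∀ a b, (fun y => christoffel (warpedMetric K L) y a b) =ᶠ[nhds x]
      fun y => warpedChristoffel (P y.1) (L y.2) (q y.2) a b := by
    intro a b
    filter_upwards [continuous_fst.continuousAt.eventually hK0,
      continuous_snd.continuousAt.eventually hL0, continuous_fst.continuousAt.eventually hK,
      continuous_snd.continuousAt.eventually hL] with y h1 h2 h3 h4
    exact christoffel_warpedMetric h1 h2 h3 h4 a b
  have hpt : ∀ a b, christoffel (warpedMetric K L) x a b =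
      warpedChristoffel (P x.1) (L x.2) (q x.2) a b := fun a b => (hev a b).eq_of_nhds
  rw [localSectionalCurvature]
  congr 1
  rw [curvatureTensor, (hev _ _).fderiv_eq, (hev _ _).fderiv_eq,
    fderiv_warpedChristoffel hP hL.self_of_nhds hq, fderiv_warpedChristoffel hP hL.self_of_nhds hq]
  simp only [hpt, warpedMetric_apply, warpedChristoffel, Prod.fst_add, Prod.fst_sub, Prod.snd_add,
    Prod.snd_sub, inner_add_left, inner_sub_left, inner_add_right, inner_sub_right,
    inner_smul_left, inner_smul_right, RCLike.conj_to_real, real_inner_comm v.2 w.2,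
    real_inner_comm w.2 (q x.2), real_inner_comm v.2 (q x.2)]
  ring

theorem gram_warpedMetric_ne_zero {K : ℝ → ℝ} {L : V → ℝ} {x : ℝ × V} (hK : 0 < K x.1)
    (hL : 0 < L x.2) {v w : ℝ × V} (h : LinearIndependent ℝ ![v, w]) :
    warpedMetric K L x v v * warpedMetric K L x w w - warpedMetric K L x v w ^ 2 ≠ 0 := by
  intro h0
  have hw : w ≠ 0 := h.ne_zero 1
  have hpos := warpedMetric_apply_self_pos hK hL hw
  have hsymm : warpedMetric K L x w v = warpedMetric K L x v w := by
    simp only [warpedMetric_apply, mul_comm w.1, real_inner_comm]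
  have hx : warpedMetric K L x w w • v + (-warpedMetric K L x v w) • w = 0 := by
    by_contra hne
    refine (warpedMetric_apply_self_pos hK hL hne).ne' ?_
    simp only [map_add, map_smul, add_apply, smul_apply, smul_eq_mul, hsymm]
    linear_combination (warpedMetric K L x w w) * h0
  exact hpos.ne' (LinearIndependent.pair_iff.1 h _ _ hx).1

theorem forall_localSectionalCurvature_warpedMetric_eq_iff [FiniteDimensional ℝ V]
    (hV : 2 ≤ Module.finrank ℝ V) {K P : ℝ → ℝ} {L : V → ℝ}
    {q : V → V} {x : ℝ × V} {p' k c : ℝ} (hK0 : ∀ᶠ s in nhds x.1, 0 < K s)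
    (hL0 : ∀ᶠ u in nhds x.2, 0 < L u)
    (hK : ∀ᶠ s in nhds x.1, HasDerivAt K (2 * P s * K s) s) (hP : HasDerivAt P p' x.1)
    (hL : ∀ᶠ u in nhds x.2, HasFDerivAt L ((2 * L u) • innerSL ℝ (q u)) u)
    (hq : HasFDerivAt q ((innerSL ℝ (q x.2)).smulRight (q x.2) -
      ((⟪q x.2, q x.2⟫ + k * L x.2) / 2) • ContinuousLinearMap.id ℝ V) x.2) :
    (∀ v w : ℝ × V, LinearIndependent ℝ ![v, w] →
      localSectionalCurvature (warpedMetric K L) x v w = c) ↔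
      -p' = c * K x.1 ∧ k - P x.1 ^ 2 = c * K x.1 := by
  have hk := hK0.self_of_nhds
  have hl := hL0.self_of_nhds
  simp only [localSectionalCurvature_warpedMetric hK0 hL0 hK hP hL hq]
  constructor
  · intro h
    obtain ⟨b⟩ : Nonempty (Fin 2 ↪ Fin (Module.finrank ℝ V)) :=
      ⟨Fin.castLEEmb hV⟩
    let e := stdOrthonormalBasis ℝ V
    have he : Orthonormal ℝ (e ∘ b) := e.orthonormal.comp b b.injective
    have h00 : ⟪e (b 0), e (b 0)⟫ = 1 := by simp
    have h11 : ⟪e (b 1), e (b 1)⟫ = 1 := by simp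
    have h01 : ⟪e (b 0), e (b 1)⟫ = 0 := he.2 (by decide : (0 : Fin 2) ≠ 1)
    constructor
    · have hind : LinearIndependent ℝ ![((1 : ℝ), (0 : V)), ((0 : ℝ), e (b 0))] := by
        rw [LinearIndependent.pair_iff]
        intro s t hst
        have h1 := congrArg Prod.fst hst
        have h2 := congrArg (fun z => ⟪e (b 0), z.2⟫) hst
        simpa [inner_add_right, inner_smul_right] using And.intro h1 h2
      have h1 := h _ _ hind
      rw [div_eq_iff (gram_warpedMetric_ne_zero hk hl hind)] at h1
      simp only [warpedMetric_apply, h00, inner_zero_left, inner_zero_right] at h1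
      have h3 : K x.1 * L x.2 * (-p' - c * K x.1) = 0 := by linear_combination h1
      have := (mul_eq_zero.1 h3).resolve_left (mul_pos hk hl).ne'
      linarith
    · have hind : LinearIndependent ℝ ![((0 : ℝ), e (b 0)), ((0 : ℝ), e (b 1))] := by
        rw [LinearIndependent.pair_iff]
        intro s t hst
        have h1 := congrArg (fun z => ⟪e (b 0), z.2⟫) hst
        have h2 := congrArg (fun z => ⟪e (b 1), z.2⟫) hst
        simpa [inner_add_right, inner_smul_right, h01, (real_inner_comm _ _).trans h01]
          using And.intro h1 h2
      have h1 := h _ _ hind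
      rw [div_eq_iff (gram_warpedMetric_ne_zero hk hl hind)] at h1
      simp only [warpedMetric_apply, h00, h01, h11] at h1
      have h3 : K x.1 * L x.2 ^ 2 * (k - P x.1 ^ 2 - c * K x.1) = 0 := by linear_combination h1
      have := (mul_eq_zero.1 h3).resolve_left (mul_pos hk (pow_pos hl 2)).ne'
      linarith
  · rintro ⟨h1, h2⟩ v w hvw
    rw [div_eq_iff (gram_warpedMetric_ne_zero hk hl hvw), h1, h2]
    simp only [warpedMetric_apply]
    ring

end Warped

/-! ## The preferred chart -/

section Chart

variable {E : Type*} [NormedAddCommGroup E] [NormedSpace ℝ E]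
  {H : Type*} [TopologicalSpace H] (I : ModelWithCorners ℝ E H) [I.Boundaryless]
  {M : Type*} [TopologicalSpace M] [ChartedSpace H M]
  {ι : Type*} [Fintype ι] {f : M → EuclideanSpace ℝ ι} {x : M}

/-- The expression of `f` in the preferred chart at `x`. -/
def chartExpr (f : M → EuclideanSpace ℝ ι) (x : M) : E → EuclideanSpace ℝ ι :=
  f ∘ (extChartAt I x).symm

theorem differential_eq_fderiv (hf : MDifferentiableAt I 𝓘(ℝ, EuclideanSpace ℝ ι) f x) :
    (differential I f x : E →L[ℝ] EuclideanSpace ℝ ι) =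
      fderiv ℝ (chartExpr I f x) (extChartAt I x x) := by
  have h := hf.mfderiv
  rw [I.range_eq_univ, fderivWithin_univ] at h
  exact h

theorem inducedForm_apply (hf : MDifferentiableAt I 𝓘(ℝ, EuclideanSpace ℝ ι) f x) (v w : E) :
    inducedForm I f x v w = ⟪fderiv ℝ (chartExpr I f x) (extChartAt I x x) v,
      fderiv ℝ (chartExpr I f x) (extChartAt I x x) w⟫ := by
  rw [← differential_eq_fderiv I hf]
  rfl

theorem normalForm_eq_of_eq_add (hf : MDifferentiableAt I 𝓘(ℝ, EuclideanSpace ℝ ι) f x)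
    {v w t : E} {X : EuclideanSpace ℝ ι}
    (hX : ∀ z, ⟪fderiv ℝ (chartExpr I f x) (extChartAt I x x) z, X⟫ = 0)
    (h : fderiv ℝ (fderiv ℝ (chartExpr I f x)) (extChartAt I x x) v w =
      X + fderiv ℝ (chartExpr I f x) (extChartAt I x x) t) :
    normalForm I f x v w = X := by
  have hD := differential_eq_fderiv I hf
  let N : Submodule ℝ (EuclideanSpace ℝ ι) :=
    (LinearMap.range (differential I f x : E →L[ℝ] EuclideanSpace ℝ ι).toLinearMap)ᗮ
  have hXN : X ∈ N := by
    rintro _ ⟨z, rfl⟩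
    rw [hD]
    exact hX z
  have htN : fderiv ℝ (chartExpr I f x) (extChartAt I x x) t ∈ Nᗮ := by
    refine Submodule.le_orthogonal_orthogonal _ ⟨t, ?_⟩
    rw [hD]
    rfl
  exact Submodule.eq_starProjection_of_mem_orthogonal' hXN htN h

theorem isQuasiUmbilicAt_of_chartExpr (hf : MDifferentiableAt I 𝓘(ℝ, EuclideanSpace ℝ ι) f x)
    {θ : E →L[ℝ] ℝ} {e : E} {η ξ : EuclideanSpace ℝ ι} {D : E →L[ℝ] EuclideanSpace ℝ ι}
    (hD : fderiv ℝ (chartExpr I f x) (extChartAt I x x) = D)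
    (hpos : ∀ v, v ≠ 0 → ⟪D v, D v⟫ ≠ 0) (hdual : ∀ v, ⟪D e, D v⟫ = θ v)
    (hη : ∀ v, ⟪D v, η⟫ = 0) (hξ : ∀ v, ⟪D v, ξ⟫ = 0)
    (hform : ∀ v w, ∃ t, fderiv ℝ (fderiv ℝ (chartExpr I f x)) (extChartAt I x x) v w =
      ⟪D v, D w⟫ • η + (θ v * θ w) • ξ + D t) :
    IsQuasiUmbilicAt I f x θ e η ξ := by
  subst hD
  refine ⟨fun v hv => ?_, fun v => ?_, fun v w => ?_⟩
  · rw [inducedForm_apply I hf]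
    exact hpos v hv
  · rw [inducedForm_apply I hf]
    exact hdual v
  · obtain ⟨t, ht⟩ := hform v w
    rw [inducedForm_apply I hf]
    refine normalForm_eq_of_eq_add I hf (fun z => ?_) ht
    rw [inner_add_right, inner_smul_right, inner_smul_right, hη, hξ]
    ring

theorem chartMetric_moebiusMetric [IsManifold I 1 M] {x₀ : M} {u : E}
    (hu : u ∈ (extChartAt I x₀).target)
    (hf : MDifferentiableAt I 𝓘(ℝ, EuclideanSpace ℝ ι) f ((extChartAt I x₀).symm u)) (v w : E) :
    chartMetric I (moebiusMetric I f) x₀ u v w = rhoSq I f ((extChartAt I x₀).symm u) *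
      ⟪fderiv ℝ (chartExpr I f x₀) u v, fderiv ℝ (chartExpr I f x₀) u w⟫ := by
  have hφ : MDifferentiableAt 𝓘(ℝ, E) I (extChartAt I x₀).symm u := by
    have := mdifferentiableWithinAt_extChartAt_symm (I := I) hu
    rwa [I.range_eq_univ, mdifferentiableWithinAt_univ] at this
  have hD : ∀ v : E, fderiv ℝ (chartExpr I f x₀) u v =
      mfderiv I 𝓘(ℝ, EuclideanSpace ℝ ι) f ((extChartAt I x₀).symm u)
        (mfderiv 𝓘(ℝ, E) I (extChartAt I x₀).symm u v) := fun v => by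
    rw [← mfderiv_eq_fderiv]
    exact mfderiv_comp_apply u hf hφ v
  rw [hD, hD]
  rfl

end Chart

/-! ## Maps of the form `m(u) A(s) + n(s) B(u)` -/

section Join

variable {V W : Type*} [NormedAddCommGroup V] [InnerProductSpace ℝ V] [NormedAddCommGroup W]
  [NormedSpace ℝ W]

/-- The map `(s, u) ↦ (a + ℓ u) A(s) + n(s) B(u)`. -/
def joinMap (a : ℝ) (l : V →L[ℝ] ℝ) (A : ℝ → W) (n : ℝ → ℝ) (B : V → W) (x : ℝ × V) : W :=
  (a + l x.2) • A x.1 + n x.1 • B x.2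

/-- The differential of `joinMap`. -/
def joinMapDeriv (a : ℝ) (l : V →L[ℝ] ℝ) (A : ℝ → W) (n : ℝ → ℝ) (B : V → W) (x : ℝ × V) :
    ℝ × V →L[ℝ] W :=
  ((ContinuousLinearMap.fst ℝ ℝ V).smulRight ((a + l x.2) • deriv A x.1 + deriv n x.1 • B x.2)) +
    (l.comp (ContinuousLinearMap.snd ℝ ℝ V)).smulRight (A x.1) +
    n x.1 • (fderiv ℝ B x.2).comp (ContinuousLinearMap.snd ℝ ℝ V)

variable {a : ℝ} {l : V →L[ℝ] ℝ} {A : ℝ → W} {n : ℝ → ℝ} {B : V → W} {J : Set ℝ}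

theorem joinMapDeriv_apply (x v : ℝ × V) : joinMapDeriv a l A n B x v =
    v.1 • ((a + l x.2) • deriv A x.1 + deriv n x.1 • B x.2) + l v.2 • A x.1 +
      n x.1 • fderiv ℝ B x.2 v.2 := by
  simp [joinMapDeriv]

theorem hasFDerivAt_joinMap {x : ℝ × V} (hA : DifferentiableAt ℝ A x.1)
    (hn : DifferentiableAt ℝ n x.1) (hB : DifferentiableAt ℝ B x.2) :
    HasFDerivAt (joinMap a l A n B) (joinMapDeriv a l A n B x) x := by
  have h := (((hasFDerivAt_comp_snd (x := x) l.hasFDerivAt).const_add a).fun_smul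
    (hasFDerivAt_comp_fst (V := V) hA.hasDerivAt)).add
    ((hasFDerivAt_comp_fst (V := V) hn.hasDerivAt).fun_smul
      (hasFDerivAt_comp_snd (x := x) hB.hasFDerivAt))
  refine h.congr_fderiv ?_
  ext v <;> simp [joinMapDeriv, smul_smul, mul_comm]

theorem contDiffOn_joinMap (hA : ContDiffOn ℝ ∞ A J) (hn : ContDiffOn ℝ ∞ n J)
    (hB : ContDiff ℝ ∞ B) : ContDiffOn ℝ ∞ (joinMap a l A n B) (J ×ˢ Set.univ) := by
  have h1 : Set.MapsTo (Prod.fst : ℝ × V → ℝ) (J ×ˢ Set.univ) J := fun x hx => hx.1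
  exact ((contDiff_const.add (l.contDiff.comp contDiff_snd)).contDiffOn.smul
    (hA.comp contDiff_fst.contDiffOn h1)).add
    ((hn.comp contDiff_fst.contDiffOn h1).smul (hB.comp contDiff_snd).contDiffOn)

theorem fderiv_joinMap (hJ : IsOpen J) (hA : ContDiffOn ℝ ∞ A J) (hn : ContDiffOn ℝ ∞ n J)
    (hB : ContDiff ℝ ∞ B) {x : ℝ × V} (hx : x.1 ∈ J) :
    fderiv ℝ (joinMap a l A n B) x = joinMapDeriv a l A n B x := by
  have hs := hJ.mem_nhds hx
  exact (hasFDerivAt_joinMap ((hA.contDiffAt hs).differentiableAt (by simp))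
    ((hn.contDiffAt hs).differentiableAt (by simp)) (hB.differentiable (by simp) _)).fderiv

theorem differentiableAt_deriv_of_contDiffOn {A : ℝ → W} (hJ : IsOpen J)
    (hA : ContDiffOn ℝ ∞ A J) {s : ℝ} (hs : s ∈ J) : DifferentiableAt ℝ (deriv A) s :=
  ((hA.deriv_of_isOpen (m := ∞) hJ (by simp)).contDiffAt (hJ.mem_nhds hs)).differentiableAt (by simp)

theorem fderiv_fderiv_joinMap (hJ : IsOpen J) (hA : ContDiffOn ℝ ∞ A J) (hn : ContDiffOn ℝ ∞ n J)
    (hB : ContDiff ℝ ∞ B) {x : ℝ × V} (hx : x.1 ∈ J) (v w : ℝ × V) :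
    fderiv ℝ (fderiv ℝ (joinMap a l A n B)) x v w =
      (v.1 * w.1) • ((a + l x.2) • deriv (deriv A) x.1 + deriv (deriv n) x.1 • B x.2) +
      (v.1 * l w.2 + w.1 * l v.2) • deriv A x.1 +
      deriv n x.1 • (v.1 • fderiv ℝ B x.2 w.2 + w.1 • fderiv ℝ B x.2 v.2) +
      n x.1 • fderiv ℝ (fderiv ℝ B) x.2 v.2 w.2 := by
  have hs := hJ.mem_nhds hx
  have hA1 := ((hA.contDiffAt hs).differentiableAt (by simp)).hasDerivAt
  have hn1 := ((hn.contDiffAt hs).differentiableAt (by simp)).hasDerivAt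
  have hA2 := (differentiableAt_deriv_of_contDiffOn hJ hA hx).hasDerivAt
  have hn2 := (differentiableAt_deriv_of_contDiffOn hJ hn hx).hasDerivAt
  have hB1 : HasFDerivAt B _ x.2 := (hB.differentiable (by simp) _).hasFDerivAt
  have hB2 : HasFDerivAt (fderiv ℝ B) _ x.2 :=
    ((hB.fderiv_right (m := ∞) (by simp)).differentiable (by simp) _).hasFDerivAt
  have hF : ContDiffAt ℝ ∞ (joinMap a l A n B) x :=
    (contDiffOn_joinMap hA hn hB).contDiffAt ((hJ.prod isOpen_univ).mem_nhds ⟨hx, trivial⟩)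
  have hF2 : DifferentiableAt ℝ (fderiv ℝ (joinMap a l A n B)) x :=
    (hF.fderiv_right (m := ∞) (by simp)).differentiableAt (by simp)
  have h1 : fderiv ℝ (fderiv ℝ (joinMap a l A n B)) x v w =
      fderiv ℝ (fun y => fderiv ℝ (joinMap a l A n B) y w) x v := by
    have := (hF2.hasFDerivAt.clm_apply (hasFDerivAt_const w x)).fderiv
    rw [this]
    simp
  have h2 : (fun y => fderiv ℝ (joinMap a l A n B) y w) =ᶠ[nhds x] fun y =>
      w.1 • ((a + l y.2) • deriv A y.1 + deriv n y.1 • B y.2) + l w.2 • A y.1 +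
      n y.1 • fderiv ℝ B y.2 w.2 := by
    filter_upwards [continuous_fst.continuousAt.eventually hs] with y hy
    rw [fderiv_joinMap hJ hA hn hB (mem_of_mem_nhds (hJ.mem_nhds hy)), joinMapDeriv_apply]
  rw [h1, h2.fderiv_eq]
  have h3 := (((((hasFDerivAt_comp_snd (x := x) l.hasFDerivAt).const_add a).fun_smul
    (hasFDerivAt_comp_fst (V := V) hA2)).fun_add ((hasFDerivAt_comp_fst (V := V) hn2).fun_smul
      (hasFDerivAt_comp_snd (x := x) hB1))).fun_const_smul w.1).fun_add
    ((hasFDerivAt_comp_fst (V := V) hA1).fun_const_smul (l w.2)) |>.fun_add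
    ((hasFDerivAt_comp_fst (V := V) hn1).fun_smul
      ((hasFDerivAt_comp_snd (x := x) hB2).clm_apply (hasFDerivAt_const w.2 x)))
  rw [h3.fderiv]
  simp
  module

end Join

/-! ## The curvature equations `u'' = k u`, `k u² - u'² = c` for `u = 1 / κ` -/

section ODE

variable {J : Set ℝ} {u κ : ℝ → ℝ} {c k : ℝ}

/-- The function `u` satisfies `u'' = k u` and `k u² - u'² = c` on `J`. -/
def SolvesCurvatureEquations (u : ℝ → ℝ) (J : Set ℝ) (k c : ℝ) : Prop :=
  ∀ s ∈ J, deriv (deriv u) s = k * u s ∧ k * u s ^ 2 - deriv u s ^ 2 = c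

theorem eq_of_hasDerivAt_zero {f : ℝ → ℝ} (hJo : IsOpen J) (hJc : J.OrdConnected)
    (hf : ∀ s ∈ J, HasDerivAt f 0 s) {s t : ℝ} (hs : s ∈ J) (ht : t ∈ J) : f s = f t :=
  hJo.is_const_of_deriv_eq_zero hJc.isPreconnected
    (fun x hx => (hf x hx).differentiableAt.differentiableWithinAt) (fun x hx => (hf x hx).deriv)
    hs ht

theorem solvesCurvatureEquations_of_eqOn {g g' g'' : ℝ → ℝ} (hJo : IsOpen J)
    (hu : ∀ s ∈ J, u s = g s) (hg : ∀ s, HasDerivAt g (g' s) s) (hg' : ∀ s, HasDerivAt g' (g'' s) s)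
    (h1 : ∀ s, g'' s = k * g s) (h2 : ∀ s, k * g s ^ 2 - g' s ^ 2 = c) :
    SolvesCurvatureEquations u J k c := by
  have hd : ∀ s ∈ J, deriv u s = g' s := fun s hs => by
    have : u =ᶠ[nhds s] g := Filter.eventually_of_mem (hJo.mem_nhds hs) hu
    rw [this.deriv_eq, (hg s).deriv]
  intro s hs
  have : deriv u =ᶠ[nhds s] g' := Filter.eventually_of_mem (hJo.mem_nhds hs) hd
  rw [this.deriv_eq, (hg' s).deriv, hd s hs, hu s hs]
  exact ⟨h1 s, h2 s⟩

theorem hasDerivAt_affine (ε s₀ s : ℝ) : HasDerivAt (fun s : ℝ => ε * s + s₀) ε s := by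
  simpa using ((hasDerivAt_id s).const_mul ε).add_const s₀

theorem solvesCurvatureEquations_zero_iff (hJo : IsOpen J) (hJc : J.OrdConnected)
    (hJn : J.Nonempty) (hκ : ∀ s ∈ J, 0 < κ s) (hu1 : ∀ s ∈ J, DifferentiableAt ℝ κ⁻¹ s)
    (hu2 : ∀ s ∈ J, DifferentiableAt ℝ (deriv κ⁻¹) s) :
    SolvesCurvatureEquations κ⁻¹ J 0 c ↔
      (c = 0 ∧ ∃ r : ℝ, 0 < r ∧ ∀ s ∈ J, κ s = 1 / r) ∨
      (c < 0 ∧ IsUpToArcLength κ J (fun t => 1 / (√(-c) * t)) (Set.Ioi 0)) := by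
  obtain ⟨a, ha⟩ := hJn
  constructor
  · intro h
    set u := κ⁻¹ with hudef
    have hpos : ∀ s ∈ J, 0 < u s := fun s hs => inv_pos.2 (hκ s hs)
    have hκu : ∀ s, κ s = 1 / u s := fun s => by simp [hudef]
    have hb : ∀ s ∈ J, deriv u s = deriv u a := fun s hs =>
      eq_of_hasDerivAt_zero hJo hJc (fun x hx => by
        have := (hu2 x hx).hasDerivAt
        rwa [(h x hx).1, zero_mul] at this) hs ha
    have hlin : ∀ s ∈ J, u s - deriv u a * s = u a - deriv u a * a := fun s hs =>
      eq_of_hasDerivAt_zero (f := fun s => u s - deriv u a * s) hJo hJc (fun x hx => by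
        refine ((hu1 x hx).hasDerivAt.sub ((hasDerivAt_id x).const_mul (deriv u a))).congr_deriv ?_
        rw [hb x hx]
        ring) hs ha
    have hc := (h a ha).2
    rcases eq_or_ne c 0 with h0 | h0
    · left
      have hd : deriv u a = 0 := by
        have : deriv u a ^ 2 = 0 := by linarith
        exact pow_eq_zero_iff (two_ne_zero) |>.1 this
      refine ⟨h0, u a, hpos a ha, fun s hs => ?_⟩
      have := hlin s hs
      rw [hκu, show u s = u a by rw [hd] at this; linarith]
    · right
      have hneg : c < 0 := lt_of_le_of_ne (by nlinarith [sq_nonneg (deriv u a)]) h0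
      have hR : 0 < √(-c) := Real.sqrt_pos.2 (by linarith)
      have hR2 : √(-c) ^ 2 = -c := Real.sq_sqrt (by linarith)
      have hex : ∃ ε : ℝ, (ε = 1 ∨ ε = -1) ∧ deriv u a = ε * √(-c) := by
        rcases sq_eq_sq_iff_eq_or_eq_neg.1
          (show deriv u a ^ 2 = √(-c) ^ 2 by rw [hR2]; linarith) with h | h
        · exact ⟨1, Or.inl rfl, by rw [h, one_mul]⟩
        · exact ⟨-1, Or.inr rfl, by rw [h]; ring⟩
      obtain ⟨ε, hε, hε'⟩ := hex
      refine ⟨hneg, ε, (u a - deriv u a * a) / √(-c), hε, fun s hs => ?_⟩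
      have hus : u s = √(-c) * (ε * s + (u a - deriv u a * a) / √(-c)) := by
        have := hlin s hs
        rw [mul_add, mul_div_cancel₀ _ hR.ne', ← this, hε']
        ring
      refine ⟨?_, by rw [hκu, hus]⟩
      have := hpos s hs
      rw [hus] at this
      exact (pos_iff_pos_of_mul_pos this).1 hR
  · rintro (⟨rfl, r, hr, h⟩ | ⟨hc, ε, s₀, hε, h⟩)
    · exact solvesCurvatureEquations_of_eqOn hJo (g := fun _ => r) (g' := fun _ => 0)
        (g'' := fun _ => 0) (fun s hs => by simp [h s hs]) (fun s => hasDerivAt_const s r)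
        (fun s => hasDerivAt_const s 0) (by simp) (by simp)
    · have hR2 : √(-c) ^ 2 = -c := Real.sq_sqrt (by linarith)
      have hε2 : ε ^ 2 = 1 := by rcases hε with rfl | rfl <;> norm_num
      refine solvesCurvatureEquations_of_eqOn hJo (g := fun s => √(-c) * (ε * s + s₀))
        (g' := fun _ => √(-c) * ε) (g'' := fun _ => 0) (fun s hs => by simp [(h s hs).2])
        (fun s => (hasDerivAt_affine ε s₀ s).const_mul _) (fun s => hasDerivAt_const s _)
        (by simp) (fun s => ?_)
      linear_combination -√(-c) ^ 2 * hε2 - hR2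

theorem solvesCurvatureEquations_neg_one_iff (hJo : IsOpen J) (hJc : J.OrdConnected)
    (hJn : J.Nonempty) (hκ : ∀ s ∈ J, 0 < κ s) (hu1 : ∀ s ∈ J, DifferentiableAt ℝ κ⁻¹ s)
    (hu2 : ∀ s ∈ J, DifferentiableAt ℝ (deriv κ⁻¹) s) :
    SolvesCurvatureEquations κ⁻¹ J (-1) c ↔
      c < 0 ∧ IsUpToArcLength κ J (fun t => 1 / (√(-c) * Real.sin t)) (Set.Ioo 0 Real.pi) := by
  obtain ⟨a, ha⟩ := hJn
  constructor
  · intro h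
    set u := κ⁻¹ with hudef
    have hpos : ∀ s ∈ J, 0 < u s := fun s hs => inv_pos.2 (hκ s hs)
    have hκu : ∀ s, κ s = 1 / u s := fun s => by simp [hudef]
    have hc := (h a ha).2
    have hua := hpos a ha
    have hneg : c < 0 := by nlinarith [sq_nonneg (deriv u a), sq_pos_of_pos hua]
    have hR : 0 < √(-c) := Real.sqrt_pos.2 (by linarith)
    have hR2 : √(-c) ^ 2 = -c := Real.sq_sqrt (by linarith)
    set R := √(-c)
    have hle : |deriv u a| ≤ R := abs_le_of_sq_le_sq (by nlinarith) hR.le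
    have hcos : Real.cos (Real.arccos (deriv u a / R)) = deriv u a / R := by
      obtain ⟨h1, h2⟩ := abs_le.1 hle
      exact Real.cos_arccos (by rw [le_div_iff₀ hR]; linarith) (by rw [div_le_one hR]; exact h2)
    have hsin : Real.sin (Real.arccos (deriv u a / R)) = u a / R := by
      rw [Real.sin_arccos, Real.sqrt_eq_iff_mul_self_eq_of_pos (by positivity)]
      field_simp
      linarith
    set t₀ := Real.arccos (deriv u a / R)
    have hd : ∀ s ∈ J, HasDerivAt u (deriv u s) s := fun s hs => (hu1 s hs).hasDerivAt
    have hd2 : ∀ s ∈ J, HasDerivAt (deriv u) (-1 * u s) s := fun s hs => by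
      rw [← (h s hs).1]
      exact (hu2 s hs).hasDerivAt
    have hsin' : ∀ s, HasDerivAt (fun s => Real.sin (1 * s + (t₀ - a)))
        (Real.cos (1 * s + (t₀ - a)) * 1) s := fun s => (hasDerivAt_affine 1 (t₀ - a) s).sin
    have hcos' : ∀ s, HasDerivAt (fun s => Real.cos (1 * s + (t₀ - a)))
        (-Real.sin (1 * s + (t₀ - a)) * 1) s := fun s => (hasDerivAt_affine 1 (t₀ - a) s).cos
    have hta : 1 * a + (t₀ - a) = t₀ := by ring
    have hA : ∀ s ∈ J, u s * Real.cos (1 * s + (t₀ - a)) - deriv u s * Real.sin (1 * s + (t₀ - a))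
        = 0 := by
      intro s hs
      have := eq_of_hasDerivAt_zero (f := fun s => u s * Real.cos (1 * s + (t₀ - a)) -
        deriv u s * Real.sin (1 * s + (t₀ - a))) hJo hJc (fun x hx => by
          refine (((hd x hx).mul (hcos' x)).sub ((hd2 x hx).mul (hsin' x))).congr_deriv ?_
          ring) hs ha
      simp only [hta, hcos, hsin] at this
      rw [this]
      ring
    have hB : ∀ s ∈ J, u s * Real.sin (1 * s + (t₀ - a)) + deriv u s * Real.cos (1 * s + (t₀ - a))
        = R := by
      intro s hs
      have := eq_of_hasDerivAt_zero (f := fun s => u s * Real.sin (1 * s + (t₀ - a)) +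
        deriv u s * Real.cos (1 * s + (t₀ - a))) hJo hJc (fun x hx => by
          refine (((hd x hx).mul (hsin' x)).add ((hd2 x hx).mul (hcos' x))).congr_deriv ?_
          ring) hs ha
      simp only [hta, hcos, hsin] at this
      rw [this]
      field_simp
      linarith
    have hus : ∀ s ∈ J, u s = R * Real.sin (1 * s + (t₀ - a)) := fun s hs => by
      linear_combination Real.cos (1 * s + (t₀ - a)) * hA s hs +
        Real.sin (1 * s + (t₀ - a)) * hB s hs - u s * Real.sin_sq_add_cos_sq (1 * s + (t₀ - a))
    have hsinpos : ∀ s ∈ J, 0 < Real.sin (1 * s + (t₀ - a)) := fun s hs => by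
      have := hpos s hs
      rw [hus s hs] at this
      exact (pos_iff_pos_of_mul_pos this).1 hR
    have ht0 : 0 ≤ t₀ := Real.arccos_nonneg _
    have ht1 : t₀ ≤ Real.pi := Real.arccos_le_pi _
    refine ⟨hneg, 1, t₀ - a, Or.inl rfl, fun s hs => ⟨⟨?_, ?_⟩, by rw [hκu, hus s hs]⟩⟩
    · by_contra! hlt
      have hmem : a - t₀ ∈ J := hJc.out hs ha ⟨by linarith, by linarith⟩
      have := hsinpos _ hmem
      rw [show 1 * (a - t₀) + (t₀ - a) = 0 by ring, Real.sin_zero] at this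
      exact lt_irrefl _ this
    · by_contra! hlt
      have hmem : a - t₀ + Real.pi ∈ J := hJc.out ha hs ⟨by linarith, by linarith⟩
      have := hsinpos _ hmem
      rw [show 1 * (a - t₀ + Real.pi) + (t₀ - a) = Real.pi by ring, Real.sin_pi] at this
      exact lt_irrefl _ this
  · rintro ⟨hc, ε, s₀, hε, h⟩
    have hR2 : √(-c) ^ 2 = -c := Real.sq_sqrt (by linarith)
    have hε2 : ε ^ 2 = 1 := by rcases hε with rfl | rfl <;> norm_num
    refine solvesCurvatureEquations_of_eqOn hJo (g := fun s => √(-c) * Real.sin (ε * s + s₀))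
      (g' := fun s => √(-c) * (Real.cos (ε * s + s₀) * ε))
      (g'' := fun s => √(-c) * (-Real.sin (ε * s + s₀) * ε * ε)) (fun s hs => by simp [(h s hs).2])
      (fun s => (hasDerivAt_affine ε s₀ s).sin.const_mul _)
      (fun s => ((hasDerivAt_affine ε s₀ s).cos.mul_const ε).const_mul _) (fun s => ?_) (fun s => ?_)
    · linear_combination -√(-c) * Real.sin (ε * s + s₀) * hε2
    · linear_combination -√(-c) ^ 2 * Real.cos (ε * s + s₀) ^ 2 * hε2 - hR2 -
        √(-c) ^ 2 * Real.sin_sq_add_cos_sq (ε * s + s₀)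

theorem solvesCurvatureEquations_one_iff (hJo : IsOpen J) (hJc : J.OrdConnected)
    (hJn : J.Nonempty) (hκ : ∀ s ∈ J, 0 < κ s) (hu1 : ∀ s ∈ J, DifferentiableAt ℝ κ⁻¹ s)
    (hu2 : ∀ s ∈ J, DifferentiableAt ℝ (deriv κ⁻¹) s) :
    SolvesCurvatureEquations κ⁻¹ J 1 c ↔
      (0 < c ∧ IsUpToArcLength κ J (fun t => 1 / (√c * Real.cosh t)) Set.univ) ∨
      (c < 0 ∧ IsUpToArcLength κ J (fun t => 1 / (√(-c) * Real.sinh t)) (Set.Ioi 0)) ∨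
      (c = 0 ∧ IsUpToArcLength κ J Real.exp Set.univ) := by
  obtain ⟨a, ha⟩ := hJn
  constructor
  · intro h
    set u := κ⁻¹ with hudef
    have hpos : ∀ s ∈ J, 0 < u s := fun s hs => inv_pos.2 (hκ s hs)
    have hκu : ∀ s, κ s = 1 / u s := fun s => by simp [hudef]
    have hd : ∀ s ∈ J, HasDerivAt u (deriv u s) s := fun s hs => (hu1 s hs).hasDerivAt
    have hd2 : ∀ s ∈ J, HasDerivAt (deriv u) (1 * u s) s := fun s hs => by
      rw [← (h s hs).1]
      exact (hu2 s hs).hasDerivAt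
    have hexp : ∀ s, HasDerivAt (fun s => Real.exp (-s)) (Real.exp (-s) * -1) s := fun s =>
      (hasDerivAt_neg s).exp
    obtain ⟨α, hα⟩ : ∃ α, ∀ s ∈ J, (u s + deriv u s) * Real.exp (-s) = α := by
      refine ⟨_, fun s hs => eq_of_hasDerivAt_zero
        (f := fun s => (u s + deriv u s) * Real.exp (-s)) hJo hJc (fun x hx => ?_) hs ha⟩
      refine (((hd x hx).add (hd2 x hx)).mul (hexp x)).congr_deriv ?_
      simp only [Pi.add_apply]
      ring
    obtain ⟨β, hβ⟩ : ∃ β, ∀ s ∈ J, (u s - deriv u s) * Real.exp s = β := by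
      refine ⟨_, fun s hs => eq_of_hasDerivAt_zero
        (f := fun s => (u s - deriv u s) * Real.exp s) hJo hJc (fun x hx => ?_) hs ha⟩
      refine (((hd x hx).sub (hd2 x hx)).mul (Real.hasDerivAt_exp x)).congr_deriv ?_
      simp only [Pi.sub_apply]
      ring
    have hee : ∀ s : ℝ, Real.exp s * Real.exp (-s) = 1 := fun s => by
      rw [← Real.exp_add, add_neg_cancel, Real.exp_zero]
    have hus : ∀ s ∈ J, u s = (α * Real.exp s + β * Real.exp (-s)) / 2 := fun s hs => by
      rw [← hα s hs, ← hβ s hs]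
      linear_combination -u s * hee s
    have hαβ : α * β = c := by
      rw [← (h a ha).2, ← hα a ha, ← hβ a ha]
      linear_combination (u a ^ 2 - deriv u a ^ 2) * hee a
    have hsum := hpos a ha
    rw [hus a ha] at hsum
    have hea := Real.exp_pos a
    have hea' := Real.exp_pos (-a)
    rcases lt_trichotomy c 0 with hc | hc | hc
    · right; left
      have hR : 0 < √(-c) := Real.sqrt_pos.2 (by linarith)
      have hR2 : √(-c) ^ 2 = -c := Real.sq_sqrt (by linarith)
      refine ⟨hc, ?_⟩
      have hfin : ∀ ε s₀ : ℝ, (∀ s ∈ J, u s = √(-c) * Real.sinh (ε * s + s₀)) →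
          ∀ s ∈ J, ε * s + s₀ ∈ Set.Ioi 0 ∧ κ s = 1 / (√(-c) * Real.sinh (ε * s + s₀)) := by
        intro ε s₀ hu s hs
        refine ⟨?_, by rw [hκu, hu s hs]⟩
        have := hpos s hs
        rw [hu s hs] at this
        exact Real.sinh_pos_iff.1 ((pos_iff_pos_of_mul_pos this).1 hR)
      rcases lt_trichotomy α 0 with hα0 | hα0 | hα0
      · have hβ0 : 0 < β := by nlinarith
        refine ⟨-1, Real.log (β / √(-c)), Or.inr rfl, hfin _ _ fun s hs => ?_⟩
        have h1 : Real.exp (-1 * s + Real.log (β / √(-c))) = Real.exp (-s) * (β / √(-c)) := by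
          rw [Real.exp_add, Real.exp_log (by positivity), neg_one_mul]
        have h2 : Real.exp (-(-1 * s + Real.log (β / √(-c)))) = Real.exp s * (√(-c) / β) := by
          rw [neg_add, Real.exp_add, Real.exp_neg (Real.log _), Real.exp_log (by positivity),
            inv_div, neg_mul, neg_neg, one_mul]
        rw [hus s hs, Real.sinh_eq, h1, h2]
        field_simp
        linear_combination Real.exp s * hαβ + Real.exp s * hR2
      · rw [hα0, zero_mul] at hαβ
        exact absurd hαβ hc.ne'
      · refine ⟨1, Real.log (α / √(-c)), Or.inl rfl, hfin _ _ fun s hs => ?_⟩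
        have h1 : Real.exp (1 * s + Real.log (α / √(-c))) = Real.exp s * (α / √(-c)) := by
          rw [Real.exp_add, Real.exp_log (by positivity), one_mul]
        have h2 : Real.exp (-(1 * s + Real.log (α / √(-c)))) = Real.exp (-s) * (√(-c) / α) := by
          rw [neg_add, Real.exp_add, Real.exp_neg (Real.log _), Real.exp_log (by positivity),
            inv_div, one_mul]
        rw [hus s hs, Real.sinh_eq, h1, h2]
        field_simp
        linear_combination Real.exp (-s) * hαβ + Real.exp (-s) * hR2
    · right; right
      refine ⟨hc, ?_⟩
      rcases mul_eq_zero.1 (hαβ.trans hc) with h0 | h0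
      · rw [h0] at hsum
        have hβ0 : 0 < β / 2 := by
          have : 0 < β * Real.exp (-a) := by linarith
          have := (pos_iff_pos_of_mul_pos this).2 hea'
          linarith
        refine ⟨1, -Real.log (β / 2), Or.inl rfl, fun s hs => ⟨trivial, ?_⟩⟩
        rw [hκu, hus s hs, h0, Real.exp_add, Real.exp_neg, Real.exp_neg, Real.exp_log hβ0, one_mul]
        field_simp
        simp
      · rw [h0] at hsum
        have hα0 : 0 < α / 2 := by
          have : 0 < α * Real.exp a := by linarith
          have := (pos_iff_pos_of_mul_pos this).2 hea
          linarith
        refine ⟨-1, -Real.log (α / 2), Or.inr rfl, fun s hs => ⟨trivial, ?_⟩⟩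
        rw [hκu, hus s hs, h0, Real.exp_add, Real.exp_neg (Real.log _), Real.exp_log hα0,
          neg_one_mul, Real.exp_neg, zero_mul, add_zero]
        have hα1 : α ≠ 0 := by
          rintro rfl
          simp at hα0
        field_simp
    · left
      have hR : 0 < √c := Real.sqrt_pos.2 hc
      have hR2 : √c ^ 2 = c := Real.sq_sqrt hc.le
      have hα0 : 0 < α := by
        by_contra! hle
        have hβ0 : β < 0 := by
          by_contra! hβ0
          nlinarith [mul_nonneg (neg_nonneg.2 hle) hβ0]
        nlinarith [mul_nonneg (neg_nonneg.2 hle) hea.le, mul_pos (neg_pos.2 hβ0) hea']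
      refine ⟨hc, 1, Real.log (α / √c), Or.inl rfl, fun s hs => ⟨trivial, ?_⟩⟩
      have h1 : Real.exp (1 * s + Real.log (α / √c)) = Real.exp s * (α / √c) := by
        rw [Real.exp_add, Real.exp_log (by positivity), one_mul]
      have h2 : Real.exp (-(1 * s + Real.log (α / √c))) = Real.exp (-s) * (√c / α) := by
        rw [neg_add, Real.exp_add, Real.exp_neg (Real.log _), Real.exp_log (by positivity),
          inv_div, one_mul]
      have hu : u s = √c * Real.cosh (1 * s + Real.log (α / √c)) := by
        rw [hus s hs, Real.cosh_eq, h1, h2]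
        field_simp
        linear_combination Real.exp (-s) * hαβ - Real.exp (-s) * hR2
      rw [hκu, hu]
  · rintro (⟨hc, ε, s₀, hε, h⟩ | ⟨hc, ε, s₀, hε, h⟩ | ⟨rfl, ε, s₀, hε, h⟩)
    · have hR2 : √c ^ 2 = c := Real.sq_sqrt hc.le
      have hε2 : ε ^ 2 = 1 := by rcases hε with rfl | rfl <;> norm_num
      refine solvesCurvatureEquations_of_eqOn hJo (g := fun s => √c * Real.cosh (ε * s + s₀))
        (g' := fun s => √c * (Real.sinh (ε * s + s₀) * ε))
        (g'' := fun s => √c * (Real.cosh (ε * s + s₀) * ε * ε)) (fun s hs => by simp [(h s hs).2])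
        (fun s => (hasDerivAt_affine ε s₀ s).cosh.const_mul _)
        (fun s => ((hasDerivAt_affine ε s₀ s).sinh.mul_const ε).const_mul _)
        (fun s => ?_) (fun s => ?_)
      · linear_combination √c * Real.cosh (ε * s + s₀) * hε2
      · linear_combination -√c ^ 2 * Real.sinh (ε * s + s₀) ^ 2 * hε2 + hR2 +
          √c ^ 2 * Real.cosh_sq_sub_sinh_sq (ε * s + s₀)
    · have hR2 : √(-c) ^ 2 = -c := Real.sq_sqrt (by linarith)
      have hε2 : ε ^ 2 = 1 := by rcases hε with rfl | rfl <;> norm_num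
      refine solvesCurvatureEquations_of_eqOn hJo (g := fun s => √(-c) * Real.sinh (ε * s + s₀))
        (g' := fun s => √(-c) * (Real.cosh (ε * s + s₀) * ε))
        (g'' := fun s => √(-c) * (Real.sinh (ε * s + s₀) * ε * ε))
        (fun s hs => by simp [(h s hs).2])
        (fun s => (hasDerivAt_affine ε s₀ s).sinh.const_mul _)
        (fun s => ((hasDerivAt_affine ε s₀ s).cosh.mul_const ε).const_mul _)
        (fun s => ?_) (fun s => ?_)
      · linear_combination √(-c) * Real.sinh (ε * s + s₀) * hε2
      · linear_combination -√(-c) ^ 2 * Real.cosh (ε * s + s₀) ^ 2 * hε2 - hR2 -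
          √(-c) ^ 2 * Real.cosh_sq_sub_sinh_sq (ε * s + s₀)
    · have hε2 : ε ^ 2 = 1 := by rcases hε with rfl | rfl <;> norm_num
      have haff : ∀ s, HasDerivAt (fun s => -(ε * s + s₀)) (-ε) s := fun s =>
        (hasDerivAt_affine ε s₀ s).neg
      refine solvesCurvatureEquations_of_eqOn hJo (g := fun s => Real.exp (-(ε * s + s₀)))
        (g' := fun s => Real.exp (-(ε * s + s₀)) * -ε)
        (g'' := fun s => Real.exp (-(ε * s + s₀)) * -ε * -ε)
        (fun s hs => by rw [Pi.inv_apply, (h s hs).2, Real.exp_neg])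
        (fun s => (haff s).exp) (fun s => (haff s).exp.mul_const (-ε)) (fun s => ?_) (fun s => ?_)
      · linear_combination Real.exp (-(ε * s + s₀)) * hε2
      · linear_combination -Real.exp (-(ε * s + s₀)) ^ 2 * hε2

end ODE

/-! ## Moebius metrics that are conformally warped products -/

section MoebiusJoin

variable {V : Type*} [NormedAddCommGroup V] [InnerProductSpace ℝ V]

/-- On `Ω`, the conformal factor `L` has logarithmic gradient `2 q`, and `q` satisfies the equation
which expresses that `L(u) |du|²` has constant curvature `k`. -/
structure IsSpaceFormFactor (L : V → ℝ) (q : V → V) (Ω : Set V) (k : ℝ) : Prop where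
  isOpen : IsOpen Ω
  nonempty : Ω.Nonempty
  pos : ∀ u ∈ Ω, 0 < L u
  hasFDerivAt : ∀ u ∈ Ω, HasFDerivAt L ((2 * L u) • innerSL ℝ (q u)) u
  hasFDerivAt_gradient : ∀ u ∈ Ω, HasFDerivAt q ((innerSL ℝ (q u)).smulRight (q u) -
    ((⟪q u, q u⟫ + k * L u) / 2) • ContinuousLinearMap.id ℝ V) u

variable {κ : ℝ → ℝ} {J : Set ℝ} {L : V → ℝ} {q : V → V} {Ω : Set V} {k c : ℝ}

theorem contDiffOn_inv_curvature (hκs : ContDiffOn ℝ ∞ κ J) (hκ : ∀ s ∈ J, 0 < κ s) :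
    ContDiffOn ℝ ∞ κ⁻¹ J :=
  hκs.inv fun s hs => (hκ s hs).ne'

theorem forall_localSectionalCurvature_eq_iff_at [FiniteDimensional ℝ V]
    (hV : 2 ≤ Module.finrank ℝ V) (hJo : IsOpen J) (hκs : ContDiffOn ℝ ∞ κ J)
    (hκ : ∀ s ∈ J, 0 < κ s) (hL : IsSpaceFormFactor L q Ω k) {x : ℝ × V} (hx : x ∈ J ×ˢ Ω) :
    (∀ v w : ℝ × V, LinearIndependent ℝ ![v, w] →
      localSectionalCurvature (warpedMetric (fun s => κ s ^ 2) L) x v w = c) ↔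
      deriv (deriv κ⁻¹) x.1 = k * κ⁻¹ x.1 ∧ k * κ⁻¹ x.1 ^ 2 - deriv κ⁻¹ x.1 ^ 2 = c := by
  have hus := contDiffOn_inv_curvature hκs hκ
  set u := κ⁻¹ with hu
  have hu1 : ∀ s ∈ J, HasDerivAt u (deriv u s) s := fun s hs =>
    ((hus.contDiffAt (hJo.mem_nhds hs)).differentiableAt (by simp)).hasDerivAt
  have hu2 : HasDerivAt (deriv u) (deriv (deriv u) x.1) x.1 :=
    (differentiableAt_deriv_of_contDiffOn hJo hus hx.1).hasDerivAt
  have hκ' : ∀ s ∈ J, HasDerivAt κ (-deriv u s * κ s ^ 2) s := fun s hs => by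
    have h := (hu1 s hs).inv (inv_pos.2 (hκ s hs)).ne'
    rw [show u⁻¹ = κ by rw [hu, inv_inv]] at h
    refine h.congr_deriv ?_
    simp [hu]
  have hP : HasDerivAt (fun s => -deriv u s * κ s)
      (-deriv (deriv u) x.1 * κ x.1 + -deriv u x.1 * (-deriv u x.1 * κ x.1 ^ 2)) x.1 :=
    hu2.neg.mul (hκ' _ hx.1)
  have hK : ∀ᶠ s in nhds x.1, HasDerivAt (fun s => κ s ^ 2)
      (2 * (-deriv u s * κ s) * κ s ^ 2) s := by
    filter_upwards [hJo.mem_nhds hx.1] with s hs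
    refine ((hκ' s hs).pow 2).congr_deriv ?_
    ring
  have hΩ := hL.isOpen.mem_nhds hx.2
  rw [forall_localSectionalCurvature_warpedMetric_eq_iff hV
    (Filter.eventually_of_mem (hJo.mem_nhds hx.1) fun s hs => pow_pos (hκ s hs) 2)
    (Filter.eventually_of_mem hΩ hL.pos) hK hP (Filter.eventually_of_mem hΩ hL.hasFDerivAt)
    (hL.hasFDerivAt_gradient _ hx.2)]
  have hk := (hκ _ hx.1).ne'
  have huk : u x.1 * κ x.1 = 1 := by simp [hu, hk]
  constructor
  · rintro ⟨h1, h2⟩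
    constructor
    · refine mul_right_cancel₀ hk ?_
      linear_combination h1 - h2 - k * huk
    · refine mul_right_cancel₀ (pow_ne_zero 2 hk) ?_
      linear_combination h2 + k * (u x.1 * κ x.1 + 1) * huk
  · rintro ⟨h1, h2⟩
    constructor
    · linear_combination κ x.1 * h1 + κ x.1 ^ 2 * h2 - k * u x.1 * κ x.1 * huk
    · linear_combination κ x.1 ^ 2 * h2 - k * (u x.1 * κ x.1 + 1) * huk

theorem hasConstantCurvatureOn_iff [FiniteDimensional ℝ V]
    (hV : 2 ≤ Module.finrank ℝ V) (hJo : IsOpen J) (hκs : ContDiffOn ℝ ∞ κ J)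
    (hκ : ∀ s ∈ J, 0 < κ s) (hL : IsSpaceFormFactor L q Ω k)
    {H : Type*} [TopologicalSpace H] (I : ModelWithCorners ℝ (ℝ × V) H)
    {M : Type*} [TopologicalSpace M] [ChartedSpace H M]
    {g : ∀ x : M, TangentSpace I x →L[ℝ] TangentSpace I x →L[ℝ] ℝ} {U : Set M}
    (hU : ∀ x ∈ U, extChartAt I x x ∈ J ×ˢ Ω) (hJU : ∀ s ∈ J, ∃ x ∈ U, (extChartAt I x x).1 = s)
    (hg : ∀ x ∈ U, chartMetric I g x =ᶠ[nhds (extChartAt I x x)]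
      warpedMetric (fun s => κ s ^ 2) L) :
    HasConstantCurvatureOn I g U c ↔ SolvesCurvatureEquations κ⁻¹ J k c := by
  have key : ∀ x ∈ U, (∀ v w : TangentSpace I x, LinearIndependent ℝ ![v, w] →
      sectionalCurvature I g x v w = c) ↔ deriv (deriv κ⁻¹) (extChartAt I x x).1 =
        k * κ⁻¹ (extChartAt I x x).1 ∧
      k * κ⁻¹ (extChartAt I x x).1 ^ 2 - deriv κ⁻¹ (extChartAt I x x).1 ^ 2 = c := fun x hx => by
    rw [← forall_localSectionalCurvature_eq_iff_at hV hJo hκs hκ hL (hU x hx)]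
    simp only [← localSectionalCurvature_congr (hg x hx)]
    rfl
  constructor
  · intro h s hs
    obtain ⟨x, hx, rfl⟩ := hJU s hs
    exact (key x hx).1 (h x hx)
  · intro h x hx
    exact (key x hx).2 (h _ (hU x hx).1)

variable {W : Type*} [NormedAddCommGroup W] [InnerProductSpace ℝ W]

/-- The map `(a + ℓ u) A(s) + n(s) B(u)` is smooth, its induced metric is `μ² (ds² + L(u) |du|²)`, and
its second fundamental form is `⟨ , ⟩ η + ds² ξ` with `‖ξ‖ = μ κ`. -/
structure IsMoebiusJoin (a : ℝ) (l : V →L[ℝ] ℝ) (A : ℝ → W) (n : ℝ → ℝ) (B : V → W) (J : Set ℝ)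
    (Ω : Set V) (κ : ℝ → ℝ) (μ : ℝ × V → ℝ) (L : V → ℝ) : Prop where
  contDiffOn_left : ContDiffOn ℝ ∞ A J
  contDiffOn_coeff : ContDiffOn ℝ ∞ n J
  contDiff_right : ContDiff ℝ ∞ B
  pos : ∀ x ∈ J ×ˢ Ω, 0 < μ x
  metric : ∀ x ∈ J ×ˢ Ω, ∀ v w, ⟪joinMapDeriv a l A n B x v, joinMapDeriv a l A n B x w⟫ =
    μ x ^ 2 * (v.1 * w.1 + L x.2 * ⟪v.2, w.2⟫)
  form : ∀ x ∈ J ×ˢ Ω, ∃ η ξ : W, (∀ v, ⟪joinMapDeriv a l A n B x v, η⟫ = 0) ∧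
    (∀ v, ⟪joinMapDeriv a l A n B x v, ξ⟫ = 0) ∧ ‖ξ‖ = μ x * κ x.1 ∧
    ∀ v w, ∃ t, fderiv ℝ (fderiv ℝ (joinMap a l A n B)) x v w =
      ⟪joinMapDeriv a l A n B x v, joinMapDeriv a l A n B x w⟫ • η + (v.1 * w.1) • ξ +
        joinMapDeriv a l A n B x t

section Manifold

variable {H : Type*} [TopologicalSpace H] (I : ModelWithCorners ℝ (ℝ × V) H) [I.Boundaryless]
  {M : Type*} [TopologicalSpace M] [ChartedSpace H M] {ι : Type*} [Fintype ι]
  {f : M → EuclideanSpace ℝ ι} {a : ℝ} {l : V →L[ℝ] ℝ} {A : ℝ → EuclideanSpace ℝ ι} {n : ℝ → ℝ}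
  {B : V → EuclideanSpace ℝ ι} {μ : ℝ × V → ℝ} {x : M}

theorem IsMoebiusJoin.isQuasiUmbilicAt (h : IsMoebiusJoin a l A n B J Ω κ μ L)
    (hJo : IsOpen J) (hL : IsSpaceFormFactor L q Ω k)
    (hf : MDifferentiableAt I 𝓘(ℝ, EuclideanSpace ℝ ι) f x)
    (hx : extChartAt I x x ∈ J ×ˢ Ω) (hF : chartExpr I f x = joinMap a l A n B) :
    ∃ η ξ, IsQuasiUmbilicAt I f x (ContinuousLinearMap.fst ℝ ℝ V)
      ((μ (extChartAt I x x) ^ 2)⁻¹, 0) η ξ ∧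
      ‖ξ‖ = μ (extChartAt I x x) * κ (extChartAt I x x).1 := by
  obtain ⟨η, ξ, hη, hξ, hξn, hform⟩ := h.form _ hx
  have hμ := h.pos _ hx
  refine ⟨η, ξ, isQuasiUmbilicAt_of_chartExpr I hf (D := joinMapDeriv a l A n B (extChartAt I x x))
    ?_ (fun v hv => ?_) (fun v => ?_) hη hξ (by rw [hF]; exact hform), hξn⟩
  · rw [hF]
    exact fderiv_joinMap hJo h.contDiffOn_left h.contDiffOn_coeff h.contDiff_right hx.1
  · rw [h.metric _ hx]
    refine mul_ne_zero (pow_ne_zero 2 hμ.ne') ?_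
    have := warpedMetric_apply_self_pos (K := fun _ => 1) (x := extChartAt I x x) one_pos
      (hL.pos _ hx.2) hv
    rw [warpedMetric_apply, one_mul] at this
    exact this.ne'
  · rw [h.metric _ hx]
    simp only [inner_zero_left, mul_zero, add_zero, ContinuousLinearMap.coe_fst']
    field_simp

theorem finrank_real_prod [FiniteDimensional ℝ V] :
    Module.finrank ℝ (ℝ × V) = 1 + Module.finrank ℝ V := by
  rw [Module.finrank_prod, Module.finrank_self]

theorem IsMoebiusJoin.rhoSq_eq [FiniteDimensional ℝ V] (hV : 2 ≤ Module.finrank ℝ V)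
    (h : IsMoebiusJoin a l A n B J Ω κ μ L)
    (hJo : IsOpen J) (hL : IsSpaceFormFactor L q Ω k)
    (hf : MDifferentiableAt I 𝓘(ℝ, EuclideanSpace ℝ ι) f x)
    (hx : extChartAt I x x ∈ J ×ˢ Ω) (hF : chartExpr I f x = joinMap a l A n B) :
    rhoSq I f x * μ (extChartAt I x x) ^ 2 = κ (extChartAt I x x).1 ^ 2 := by
  obtain ⟨η, ξ, hq, hξ⟩ := h.isQuasiUmbilicAt I hJo hL hf hx hF
  have hμ := (h.pos _ hx).ne'
  rw [hq.rhoSq_eq (by rw [finrank_real_prod]; omega), hξ]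
  simp only [ContinuousLinearMap.coe_fst']
  field_simp

theorem IsMoebiusJoin.moebiusMetric_apply [FiniteDimensional ℝ V] (hV : 2 ≤ Module.finrank ℝ V)
    (h : IsMoebiusJoin a l A n B J Ω κ μ L)
    (hJo : IsOpen J) (hL : IsSpaceFormFactor L q Ω k)
    (hf : MDifferentiableAt I 𝓘(ℝ, EuclideanSpace ℝ ι) f x)
    (hx : extChartAt I x x ∈ J ×ˢ Ω) (hF : chartExpr I f x = joinMap a l A n B) (v w : ℝ × V) :
    moebiusMetric I f x v w = κ (extChartAt I x x).1 ^ 2 *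
      (v.1 * w.1 + L (extChartAt I x x).2 * ⟪v.2, w.2⟫) := by
  have h1 : moebiusMetric I f x v w = rhoSq I f x * inducedForm I f x v w := rfl
  rw [h1, inducedForm_apply I hf, hF,
    fderiv_joinMap hJo h.contDiffOn_left h.contDiffOn_coeff h.contDiff_right hx.1,
    h.metric _ hx, ← mul_assoc, h.rhoSq_eq I hV hJo hL hf hx hF]

theorem IsMoebiusJoin.not_umbilic [FiniteDimensional ℝ V] (hV : 2 ≤ Module.finrank ℝ V)
    (h : IsMoebiusJoin a l A n B J Ω κ μ L)
    (hJo : IsOpen J) (hL : IsSpaceFormFactor L q Ω k) (hκ : ∀ s ∈ J, 0 < κ s)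
    (hf : MDifferentiableAt I 𝓘(ℝ, EuclideanSpace ℝ ι) f x)
    (hx : extChartAt I x x ∈ J ×ˢ Ω) (hF : chartExpr I f x = joinMap a l A n B) :
    ¬ ∃ η' : EuclideanSpace ℝ ι, ∀ v w : TangentSpace I x,
      secondFundamentalForm I f x v w = inducedMetric I f x v w • η' := by
  obtain ⟨η, ξ, hq, hξ⟩ := h.isQuasiUmbilicAt I hJo hL hf hx hF
  have hμ := h.pos _ hx
  have : Nontrivial V := Module.nontrivial_of_finrank_pos (R := ℝ) (by omega)
  obtain ⟨u, hu⟩ := exists_ne (0 : V)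
  refine hq.not_umbilic (v := (0, u)) (fun h0 => hu (congrArg Prod.snd h0)) rfl ?_ ?_
  · simpa using hμ.ne'
  · rw [← norm_pos_iff, hξ]
    exact mul_pos hμ (hκ _ hx.1)

theorem IsMoebiusJoin.differential_injective (h : IsMoebiusJoin a l A n B J Ω κ μ L)
    (hJo : IsOpen J) (hL : IsSpaceFormFactor L q Ω k)
    (hf : MDifferentiableAt I 𝓘(ℝ, EuclideanSpace ℝ ι) f x)
    (hx : extChartAt I x x ∈ J ×ˢ Ω) (hF : chartExpr I f x = joinMap a l A n B) :
    Function.Injective (differential I f x) := by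
  obtain ⟨η, ξ, hq, hξ⟩ := h.isQuasiUmbilicAt I hJo hL hf hx hF
  have key : ∀ v : ℝ × V, (differential I f x : ℝ × V →L[ℝ] EuclideanSpace ℝ ι) v = 0 → v = 0 := by
    intro v hv
    by_contra hne
    refine hq.ne_zero v hne ?_
    have hv' : fderiv ℝ (chartExpr I f x) (extChartAt I x x) v = 0 := by
      rw [← differential_eq_fderiv I hf]
      exact hv
    rw [inducedForm_apply I hf, hv', inner_zero_left]
  exact (injective_iff_map_eq_zero (differential I f x)).2 key

/-- The geometry of an immersion which is everywhere a Moebius join in the preferred charts. -/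
theorem moebius_geometry_of_isMoebiusJoin [IsManifold I 1 M] [FiniteDimensional ℝ V]
    (hV : 2 ≤ Module.finrank ℝ V) (hJo : IsOpen J) (hκs : ContDiffOn ℝ ∞ κ J)
    (hκ : ∀ s ∈ J, 0 < κ s) (hL : IsSpaceFormFactor L q Ω k) {U : Set M} (hU : IsOpen U)
    (hf : ContMDiffOn I 𝓘(ℝ, EuclideanSpace ℝ ι) ∞ f U)
    (hUJ : ∀ x ∈ U, extChartAt I x x ∈ J ×ˢ Ω) (hJU : ∀ s ∈ J, ∃ x ∈ U, (extChartAt I x x).1 = s)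
    (hB : ∀ x ∈ U, ∃ B, chartExpr I f x = joinMap a l A n B ∧ IsMoebiusJoin a l A n B J Ω κ μ L)
    (hμ : ∀ x ∈ U, ∀ᶠ y in nhds (extChartAt I x x),
      (extChartAt I ((extChartAt I x).symm y) ((extChartAt I x).symm y)).1 = y.1 ∧
      μ (extChartAt I ((extChartAt I x).symm y) ((extChartAt I x).symm y)) = μ y) :
    IsImmersionOn I f U ∧ IsUmbilicFreeOn I f U ∧
      (∀ x ∈ U, ∀ v w : ℝ × V, moebiusMetric I f x v w = κ (extChartAt I x x).1 ^ 2 *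
        (v.1 * w.1 + L (extChartAt I x x).2 * ⟪v.2, w.2⟫)) ∧
      (HasConstantCurvatureOn I (moebiusMetric I f) U c ↔ SolvesCurvatureEquations κ⁻¹ J k c) := by
  have hf1 : ∀ x ∈ U, MDifferentiableAt I 𝓘(ℝ, EuclideanSpace ℝ ι) f x := fun x hx =>
    ((hf x hx).contMDiffAt (hU.mem_nhds hx)).mdifferentiableAt (by simp)
  refine ⟨⟨hf, fun x hx => ?_⟩, fun x hx => ?_, fun x hx v w => ?_, ?_⟩
  · obtain ⟨B, hF, h⟩ := hB x hx
    exact h.differential_injective I hJo hL (hf1 x hx) (hUJ x hx) hF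
  · obtain ⟨B, hF, h⟩ := hB x hx
    exact h.not_umbilic I hV hJo hL hκ (hf1 x hx) (hUJ x hx) hF
  · obtain ⟨B, hF, h⟩ := hB x hx
    exact h.moebiusMetric_apply I hV hJo hL (hf1 x hx) (hUJ x hx) hF v w
  · refine hasConstantCurvatureOn_iff hV hJo hκs hκ hL I hUJ hJU fun x hx => ?_
    obtain ⟨B, hF, h⟩ := hB x hx
    have hcont : ContinuousAt (extChartAt I x).symm (extChartAt I x x) :=
      continuousAt_extChartAt_symm x
    have hmem : ∀ᶠ y in nhds (extChartAt I x x), (extChartAt I x).symm y ∈ U := by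
      refine hcont.eventually ?_
      rw [extChartAt_to_inv]
      exact hU.mem_nhds hx
    filter_upwards [hμ x hx, hmem, extChartAt_target_mem_nhds (I := I) x,
      (hJo.prod hL.isOpen).mem_nhds (hUJ x hx)] with y hy hyU hyt hyJ
    obtain ⟨B', hF', h'⟩ := hB _ hyU
    have hρ := h'.rhoSq_eq I hV hJo hL (hf1 _ hyU) (hUJ _ hyU) hF'
    rw [hy.1, hy.2] at hρ
    refine ContinuousLinearMap.ext fun v => ContinuousLinearMap.ext fun w => ?_
    rw [chartMetric_moebiusMetric I hyt (hf1 _ hyU), hF,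
      fderiv_joinMap hJo h.contDiffOn_left h.contDiffOn_coeff h.contDiff_right hyJ.1,
      h.metric _ hyJ, ← mul_assoc, hρ, warpedMetric_apply]

end Manifold

end MoebiusJoin

/-! ## The conformal factors of the space forms -/

section SpaceForms

theorem isSpaceFormFactor_one (V : Type*) [NormedAddCommGroup V] [InnerProductSpace ℝ V] :
    IsSpaceFormFactor (fun _ : V => 1) (fun _ => 0) Set.univ 0 where
  isOpen := isOpen_univ
  nonempty := Set.univ_nonempty
  pos _ _ := one_pos
  hasFDerivAt u _ := (hasFDerivAt_const (1 : ℝ) u).congr_fderiv (by simp)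
  hasFDerivAt_gradient u _ := (hasFDerivAt_const (0 : V) u).congr_fderiv (by ext; simp)

theorem isSpaceFormFactor_hyperbolic (m : ℕ) (i : Fin m) :
    IsSpaceFormFactor (fun z : EuclideanSpace ℝ (Fin m) => 1 / z i ^ 2)
      (fun z => -(z i)⁻¹ • EuclideanSpace.single i (1 : ℝ)) {z | 0 < z i} (-1) where
  isOpen := isOpen_lt continuous_const (EuclideanSpace.proj (𝕜 := ℝ) i).continuous
  nonempty := ⟨EuclideanSpace.single i 1, by simp⟩
  pos u hu := one_div_pos.2 (pow_pos hu 2)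
  hasFDerivAt u hu := by
    have hu0 : u i ≠ 0 := ne_of_gt hu
    have h := ((EuclideanSpace.proj (𝕜 := ℝ) i).hasFDerivAt (x := u)).pow 2
    have h2 := (hasDerivAt_inv (pow_ne_zero 2 hu0)).comp_hasFDerivAt u h
    simp only [one_div]
    refine h2.congr_fderiv ?_
    ext v
    simp [EuclideanSpace.inner_single_left]
    field_simp
  hasFDerivAt_gradient u hu := by
    have hu0 : u i ≠ 0 := ne_of_gt hu
    have h := (EuclideanSpace.proj (𝕜 := ℝ) i).hasFDerivAt (x := u)
    have h2 := ((hasDerivAt_inv hu0).comp_hasFDerivAt u h).neg.smul_const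
      (EuclideanSpace.single i (1 : ℝ))
    refine h2.congr_fderiv ?_
    ext1 v
    simp [EuclideanSpace.inner_single_left, smul_smul, norm_smul]
    field_simp

variable {V : Type*} [NormedAddCommGroup V] [InnerProductSpace ℝ V]

theorem hasFDerivAt_inv_norm_sq_add_four (u : V) :
    HasFDerivAt (fun u : V => (‖u‖ ^ 2 + 4)⁻¹)
      ((-2 * ((‖u‖ ^ 2 + 4)⁻¹) ^ 2) • innerSL ℝ u) u := by
  have h4 : ‖u‖ ^ 2 + 4 ≠ 0 := by positivity
  have h := (hasStrictFDerivAt_norm_sq u).hasFDerivAt.add_const (4 : ℝ)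
  refine ((hasDerivAt_inv h4).comp_hasFDerivAt u h).congr_fderiv ?_
  ext v
  simp
  ring

theorem isSpaceFormFactor_sphere (V : Type*) [NormedAddCommGroup V] [InnerProductSpace ℝ V] :
    IsSpaceFormFactor (fun u : V => 16 * ((‖u‖ ^ 2 + 4)⁻¹) ^ 2)
      (fun u => (-2 * (‖u‖ ^ 2 + 4)⁻¹) • u) Set.univ 1 where
  isOpen := isOpen_univ
  nonempty := Set.univ_nonempty
  pos u _ := by positivity
  hasFDerivAt u _ := by
    refine (((hasFDerivAt_inv_norm_sq_add_four u).pow 2).const_mul 16).congr_fderiv ?_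
    ext v
    simp
    ring
  hasFDerivAt_gradient u _ := by
    refine (((hasFDerivAt_inv_norm_sq_add_four u).const_mul (-2)).smul
      (hasFDerivAt_id u)).congr_fderiv ?_
    have h4 : ‖u‖ ^ 2 + 4 ≠ 0 := by positivity
    ext1 v
    simp only [add_apply, smul_apply, sub_apply, ContinuousLinearMap.smulRight_apply,
      ContinuousLinearMap.id_apply, innerSL_apply_apply, inner_smul_left, inner_smul_right,
      RCLike.conj_to_real, real_inner_self_eq_norm_sq, id_eq, smul_eq_mul]
    match_scalars
    · field_simp
      ring
    · ring

/-- A parametrization of part of the unit sphere by a conformal map with factor `L`. -/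
structure IsConformalSphereMap {F : Type*} [NormedAddCommGroup F] [InnerProductSpace ℝ F]
    (B : V → F) (L : V → ℝ) : Prop where
  contDiff : ContDiff ℝ ∞ B
  inner_self : ∀ u, ⟪B u, B u⟫ = 1
  inner_fderiv_self : ∀ u v, ⟪fderiv ℝ B u v, B u⟫ = 0
  inner_fderiv : ∀ u v w, ⟪fderiv ℝ B u v, fderiv ℝ B u w⟫ = L u * ⟪v, w⟫
  fderiv_fderiv : ∀ u v w, ∃ t,
    fderiv ℝ (fderiv ℝ B) u v w = fderiv ℝ B u t - (L u * ⟪v, w⟫) • B u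

theorem isConformalSphereMap_stereographic {F : Type*} [NormedAddCommGroup F]
    [InnerProductSpace ℝ F] (T : V →ₗᵢ[ℝ] F) {p : F} (hp : ‖p‖ = 1) (hT : ∀ u, ⟪T u, p⟫ = 0) :
    IsConformalSphereMap
      (fun u => (‖u‖ ^ 2 + 4)⁻¹ • ((4 : ℝ) • T u + (‖u‖ ^ 2 - 4) • p))
      (fun u => 16 * ((‖u‖ ^ 2 + 4)⁻¹) ^ 2) := by
  have hpp : ⟪p, p⟫ = 1 := by rw [real_inner_self_eq_norm_sq, hp, one_pow]
  have hpT : ∀ u, ⟪p, T u⟫ = 0 := fun u => (real_inner_comm _ _).trans (hT u)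
  have hTT : ∀ u v, ⟪T u, T v⟫ = ⟪u, v⟫ := T.inner_map_map
  have hns : ∀ u : V, HasFDerivAt (fun u : V => ‖u‖ ^ 2) ((2 : ℝ) • innerSL ℝ u) u := fun u =>
    (hasStrictFDerivAt_norm_sq u).hasFDerivAt.congr_fderiv (by ext; simp)
  have hTd : ∀ u, HasFDerivAt T T.toContinuousLinearMap u := fun u =>
    T.toContinuousLinearMap.hasFDerivAt
  set B : V → F := fun u => (‖u‖ ^ 2 + 4)⁻¹ • ((4 : ℝ) • T u + (‖u‖ ^ 2 - 4) • p) with hB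
  have hcd : ContDiff ℝ ∞ B := by
    have h0 : ContDiff ℝ ∞ fun u : V => ‖u‖ ^ 2 := contDiff_norm_sq ℝ
    exact ((h0.add contDiff_const).inv fun u => by positivity).smul
      ((contDiff_const.smul T.toContinuousLinearMap.contDiff).add
        ((h0.sub contDiff_const).smul contDiff_const))
  have hd : ∀ u v, fderiv ℝ B u v = (4 * (‖u‖ ^ 2 + 4)⁻¹) • T v +
      (-2 * ((‖u‖ ^ 2 + 4)⁻¹) ^ 2 * ⟪u, v⟫) • ((4 : ℝ) • T u - (8 : ℝ) • p) := by
    intro u v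
    have h4 : ‖u‖ ^ 2 + 4 ≠ 0 := by positivity
    have h := (hasFDerivAt_inv_norm_sq_add_four u).fun_smul
      (((hTd u).fun_const_smul (4 : ℝ)).fun_add (((hns u).sub_const 4).smul_const p))
    have h' : HasFDerivAt B _ u := h
    rw [h'.fderiv]
    simp only [add_apply, smul_apply, ContinuousLinearMap.smulRight_apply, innerSL_apply_apply,
      LinearIsometry.coe_toContinuousLinearMap, smul_eq_mul]
    match_scalars <;> simp <;> field_simp
    ring
  have hdd : ∀ u v w, fderiv ℝ (fderiv ℝ B) u v w =
      (-8 * ((‖u‖ ^ 2 + 4)⁻¹) ^ 2 * ⟪u, v⟫) • T w +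
      (8 * ((‖u‖ ^ 2 + 4)⁻¹) ^ 3 * ⟪u, v⟫ * ⟪u, w⟫ - 2 * ((‖u‖ ^ 2 + 4)⁻¹) ^ 2 * ⟪v, w⟫) •
        ((4 : ℝ) • T u - (8 : ℝ) • p) +
      (-8 * ((‖u‖ ^ 2 + 4)⁻¹) ^ 2 * ⟪u, w⟫) • T v := by
    intro u v w
    have hF2 : DifferentiableAt ℝ (fderiv ℝ B) u :=
      (hcd.fderiv_right (m := ∞) (by simp)).differentiable (by simp) u
    have h1 : fderiv ℝ (fderiv ℝ B) u v w = fderiv ℝ (fun y => fderiv ℝ B y w) u v := by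
      rw [(hF2.hasFDerivAt.clm_apply (hasFDerivAt_const w u)).fderiv]
      simp
    rw [h1, show (fun y => fderiv ℝ B y w) = _ from funext fun y => hd y w]
    have hr := hasFDerivAt_inv_norm_sq_add_four u
    have hin : HasFDerivAt (fun y : V => ⟪y, w⟫) (innerSL ℝ w) u :=
      ((innerSL ℝ w).hasFDerivAt (x := u)).congr_of_eventuallyEq
        (Filter.Eventually.of_forall fun y => real_inner_comm _ _)
    have h := ((hr.const_mul 4).smul_const (T w)).fun_add
      ((((hr.pow 2).const_mul (-2)).fun_mul hin).fun_smul
        (((hTd u).fun_const_smul (4 : ℝ)).sub_const ((8 : ℝ) • p)))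
    have h' : fderiv ℝ (fun y => (4 * (‖y‖ ^ 2 + 4)⁻¹) • T w +
      (-2 * ((‖y‖ ^ 2 + 4)⁻¹) ^ 2 * ⟪y, w⟫) • ((4 : ℝ) • T y - (8 : ℝ) • p)) u = _ := h.fderiv
    rw [h']
    simp only [add_apply, smul_apply, ContinuousLinearMap.smulRight_apply, innerSL_apply_apply,
      LinearIsometry.coe_toContinuousLinearMap, smul_eq_mul, real_inner_comm v w]
    generalize (‖u‖ ^ 2 + 4)⁻¹ = r
    match_scalars <;> simp <;> ring
  refine ⟨hcd, fun u => ?_, fun u v => ?_, fun u v w => ?_, fun u v w => ?_⟩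
  · have h4 : ‖u‖ ^ 2 + 4 ≠ 0 := by positivity
    simp only [hB, inner_add_left, inner_add_right, inner_smul_left, inner_smul_right, hTT, hT,
      hpT, hpp, RCLike.conj_to_real, real_inner_self_eq_norm_sq]
    field_simp
    ring
  · have h4 : ‖u‖ ^ 2 + 4 ≠ 0 := by positivity
    rw [hd]
    simp only [hB, inner_add_left, inner_add_right, inner_sub_left, inner_smul_left,
      inner_smul_right, hTT, hT, hpT, hpp, RCLike.conj_to_real, real_inner_self_eq_norm_sq,
      real_inner_comm u v]
    field_simp
    ring
  · have h4 : ‖u‖ ^ 2 + 4 ≠ 0 := by positivity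
    rw [hd, hd]
    simp only [inner_add_left, inner_add_right, inner_sub_left, inner_sub_right, inner_smul_left,
      inner_smul_right, hTT, hT, hpT, hpp, RCLike.conj_to_real, real_inner_self_eq_norm_sq,
      real_inner_comm u v]
    field_simp
    ring
  · have h4 : ‖u‖ ^ 2 + 4 ≠ 0 := by positivity
    refine ⟨(-2 * (‖u‖ ^ 2 + 4)⁻¹) • (⟪u, v⟫ • w + ⟪u, w⟫ • v - ⟪v, w⟫ • u), ?_⟩
    rw [hdd, hd]
    simp only [hB, map_add, map_sub, map_smul, inner_add_right, inner_sub_right, inner_smul_right,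
      real_inner_self_eq_norm_sq]
    match_scalars <;> field_simp <;> ring

end SpaceForms

/-! ## The ambient space `ℝ^a × ℝ^b` -/

section Ambient

/-- The inclusion of the first factor of `ℝ^a × ℝ^b`. -/
def inlL (a b : ℕ) : EuclideanSpace ℝ (Fin a) →L[ℝ] EuclideanSpace ℝ (Fin a ⊕ Fin b) :=
  LinearMap.toContinuousLinearMap
    { toFun := fun x => euclideanPair x 0
      map_add' := fun x y => by ext i; rcases i with i | i <;> simp [euclideanPair]
      map_smul' := fun r x => by ext i; rcases i with i | i <;> simp [euclideanPair] }

/-- The inclusion of the second factor of `ℝ^a × ℝ^b`. -/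
def inrL (a b : ℕ) : EuclideanSpace ℝ (Fin b) →L[ℝ] EuclideanSpace ℝ (Fin a ⊕ Fin b) :=
  LinearMap.toContinuousLinearMap
    { toFun := fun y => euclideanPair 0 y
      map_add' := fun x y => by ext i; rcases i with i | i <;> simp [euclideanPair]
      map_smul' := fun r x => by ext i; rcases i with i | i <;> simp [euclideanPair] }

theorem inlL_apply {a b : ℕ} (x : EuclideanSpace ℝ (Fin a)) : inlL a b x = euclideanPair x 0 := rfl

theorem inrL_apply {a b : ℕ} (y : EuclideanSpace ℝ (Fin b)) : inrL a b y = euclideanPair 0 y := rfl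

theorem euclideanPair_eq {a b : ℕ} (x : Fin a → ℝ) (y : Fin b → ℝ) :
    euclideanPair x y = inlL a b (WithLp.toLp 2 x) + inrL a b (WithLp.toLp 2 y) := by
  ext i
  rcases i with i | i <;> simp [inlL_apply, inrL_apply, euclideanPair]

@[simp] theorem inner_inlL_inlL {a b : ℕ} (x y : EuclideanSpace ℝ (Fin a)) :
    ⟪inlL a b x, inlL a b y⟫ = ⟪x, y⟫ := by
  simp [inlL_apply, euclideanPair, PiLp.inner_apply]

@[simp] theorem inner_inrL_inrL {a b : ℕ} (x y : EuclideanSpace ℝ (Fin b)) :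
    ⟪inrL a b x, inrL a b y⟫ = ⟪x, y⟫ := by
  simp [inrL_apply, euclideanPair, PiLp.inner_apply]

@[simp] theorem inner_inlL_inrL {a b : ℕ} (x : EuclideanSpace ℝ (Fin a))
    (y : EuclideanSpace ℝ (Fin b)) : ⟪inlL a b x, inrL a b y⟫ = 0 := by
  simp [inlL_apply, inrL_apply, euclideanPair, PiLp.inner_apply]

@[simp] theorem inner_inrL_inlL {a b : ℕ} (x : EuclideanSpace ℝ (Fin a))
    (y : EuclideanSpace ℝ (Fin b)) : ⟪inrL a b y, inlL a b x⟫ = 0 := by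
  rw [real_inner_comm, inner_inlL_inrL]

/-- The projection of `ℝ^{b + 1}` to the last `b` coordinates. -/
def tailL (b : ℕ) : EuclideanSpace ℝ (Fin (b + 1)) →L[ℝ] EuclideanSpace ℝ (Fin b) :=
  LinearMap.toContinuousLinearMap
    { toFun := fun x => WithLp.toLp 2 fun i => x i.succ
      map_add' := fun x y => by ext i; simp
      map_smul' := fun r x => by ext i; simp }

/-- The projection of `ℝ^{a + 1}` to the first `a` coordinates. -/
def initL (a : ℕ) : EuclideanSpace ℝ (Fin (a + 1)) →L[ℝ] EuclideanSpace ℝ (Fin a) :=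
  LinearMap.toContinuousLinearMap
    { toFun := fun x => WithLp.toLp 2 fun i => x i.castSucc
      map_add' := fun x y => by ext i; simp
      map_smul' := fun r x => by ext i; simp }

theorem tailL_apply {b : ℕ} (x : EuclideanSpace ℝ (Fin (b + 1))) :
    tailL b x = WithLp.toLp 2 fun i => x i.succ := rfl

theorem initL_apply {a : ℕ} (x : EuclideanSpace ℝ (Fin (a + 1))) :
    initL a x = WithLp.toLp 2 fun i => x i.castSucc := rfl

theorem inner_eq_zero_add_tail {b : ℕ} (x y : EuclideanSpace ℝ (Fin (b + 1))) :
    ⟪x, y⟫ = x 0 * y 0 + ⟪tailL b x, tailL b y⟫ := by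
  simp [PiLp.inner_apply, Fin.sum_univ_succ, tailL_apply, mul_comm]

theorem inner_eq_init_add_last {a : ℕ} (x y : EuclideanSpace ℝ (Fin (a + 1))) :
    ⟪x, y⟫ = ⟪initL a x, initL a y⟫ + x (Fin.last a) * y (Fin.last a) := by
  simp [PiLp.inner_apply, Fin.sum_univ_castSucc, initL_apply, mul_comm]

theorem cylinder_eq_joinMap {a b : ℕ} (γ : ℝ → EuclideanSpace ℝ (Fin a)) :
    cylinder (b := b) γ = joinMap 1 0 (fun s => inlL a b (γ s)) (fun _ => 1) (inrL a b) := by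
  funext x
  simp [cylinder, joinMap, euclideanPair_eq]

theorem generalizedCone_eq_joinMap {a b : ℕ} (γ : ℝ → EuclideanSpace ℝ (Fin a)) :
    generalizedCone (b := b) γ = joinMap 0 (EuclideanSpace.proj 0) (fun s => inlL a b (γ s))
      (fun _ => 1) (fun z => inrL a b (tailL b z)) := by
  funext x
  rw [generalizedCone, euclideanPair_eq, joinMap, tailL_apply, ← map_smul]
  simp

theorem rotational_eq {a b : ℕ} (γ : ℝ → EuclideanSpace ℝ (Fin (a + 1)))
    (x : ℝ × Metric.sphere (0 : EuclideanSpace ℝ (Fin b)) 1) :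
    rotational γ x = inlL a b (initL a (γ x.1)) +
      γ x.1 (Fin.last a) • inrL a b (x.2 : EuclideanSpace ℝ (Fin b)) := by
  rw [rotational, euclideanPair_eq, initL_apply, ← map_smul]
  simp

end Ambient

/-! ## Curves -/

section Curves

variable {J : Set ℝ} {F W : Type*} [NormedAddCommGroup F] [InnerProductSpace ℝ F]
  [NormedAddCommGroup W] [NormedSpace ℝ W]

theorem deriv_clm_comp (T : F →L[ℝ] W) {γ : ℝ → F} {s : ℝ} (h : DifferentiableAt ℝ γ s) :
    deriv (fun s => T (γ s)) s = T (deriv γ s) :=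
  (T.hasFDerivAt.comp_hasDerivAt s h.hasDerivAt).deriv

theorem differentiableAt_of_contDiffOn {γ : ℝ → F} (hJ : IsOpen J) (hγ : ContDiffOn ℝ ∞ γ J) {s : ℝ}
    (hs : s ∈ J) : DifferentiableAt ℝ γ s :=
  (hγ.contDiffAt (hJ.mem_nhds hs)).differentiableAt (by simp)

theorem deriv_deriv_clm_comp (T : F →L[ℝ] W) {γ : ℝ → F} (hJ : IsOpen J)
    (hγ : ContDiffOn ℝ ∞ γ J) {s : ℝ} (hs : s ∈ J) :
    deriv (deriv fun s => T (γ s)) s = T (deriv (deriv γ) s) := by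
  have : deriv (fun s => T (γ s)) =ᶠ[nhds s] fun s => T (deriv γ s) :=
    Filter.eventually_of_mem (hJ.mem_nhds hs) fun t ht =>
      deriv_clm_comp T (differentiableAt_of_contDiffOn hJ hγ ht)
  rw [this.deriv_eq, deriv_clm_comp T (differentiableAt_deriv_of_contDiffOn hJ hγ hs)]

theorem contDiffOn_deriv {γ : ℝ → F} (hJ : IsOpen J) (hγ : ContDiffOn ℝ ∞ γ J) :
    ContDiffOn ℝ ∞ (deriv γ) J :=
  hγ.deriv_of_isOpen (m := ∞) hJ (by simp)

theorem inner_deriv_add_of_inner_eq {f g : ℝ → F} {h : ℝ → ℝ} {h' s : ℝ} (hJ : IsOpen J)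
    (hfg : ∀ s ∈ J, ⟪f s, g s⟫ = h s) (hs : s ∈ J) (hf : DifferentiableAt ℝ f s)
    (hg : DifferentiableAt ℝ g s) (hh : HasDerivAt h h' s) :
    ⟪f s, deriv g s⟫ + ⟪deriv f s, g s⟫ = h' := by
  have h1 := hf.hasDerivAt.inner ℝ hg.hasDerivAt
  have h2 := hh.congr_of_eventuallyEq (Filter.eventually_of_mem (hJ.mem_nhds hs) hfg)
  exact h1.unique h2

theorem inner_deriv_deriv_deriv_eq_zero {γ : ℝ → F} (hJ : IsOpen J) (hγ : ContDiffOn ℝ ∞ γ J)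
    (h1 : ∀ s ∈ J, ‖deriv γ s‖ = 1) {s : ℝ} (hs : s ∈ J) : ⟪deriv γ s, deriv (deriv γ) s⟫ = 0 := by
  have hd := differentiableAt_deriv_of_contDiffOn hJ hγ hs
  have := inner_deriv_add_of_inner_eq (h := fun _ => 1) hJ
    (fun s hs => by rw [real_inner_self_eq_norm_sq, h1 s hs, one_pow]) hs hd hd
    (hasDerivAt_const s 1)
  rw [real_inner_comm] at this
  linarith [real_inner_comm (deriv γ s) (deriv (deriv γ) s)]

variable {V : Type*} [NormedAddCommGroup V] [InnerProductSpace ℝ V]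

theorem fderiv_clm (T : V →L[ℝ] W) : fderiv ℝ T = fun _ => T := funext fun _ => T.fderiv

theorem fderiv_fderiv_clm (T : V →L[ℝ] W) (u : V) : fderiv ℝ (fderiv ℝ T) u = 0 := by
  rw [fderiv_clm]
  simp

theorem fderiv_clm_comp (T : F →L[ℝ] W) {B : V → F} {u : V} (hB : DifferentiableAt ℝ B u) (v : V) :
    fderiv ℝ (fun u => T (B u)) u v = T (fderiv ℝ B u v) := by
  have h : HasFDerivAt (fun u => T (B u)) _ u := T.hasFDerivAt.comp u hB.hasFDerivAt
  rw [h.fderiv]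
  rfl

theorem fderiv_fderiv_clm_comp (T : F →L[ℝ] W) {B : V → F} (hB : ContDiff ℝ ∞ B) (u v w : V) :
    fderiv ℝ (fderiv ℝ fun u => T (B u)) u v w = T (fderiv ℝ (fderiv ℝ B) u v w) := by
  have h1 : (fderiv ℝ fun u => T (B u)) = fun u => T.comp (fderiv ℝ B u) := by
    ext u v
    exact fderiv_clm_comp T (hB.differentiable (by simp) u) v
  have hB2 : DifferentiableAt ℝ (fderiv ℝ B) u :=
    (hB.fderiv_right (m := ∞) (by simp)).differentiable (by simp) u
  have h2 : HasFDerivAt (fun u => T.comp (fderiv ℝ B u)) _ u :=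
    (ContinuousLinearMap.compL ℝ V F W T).hasFDerivAt.comp u hB2.hasFDerivAt
  rw [h1, h2.fderiv]
  rfl

end Curves

/-! ## The three types of immersions are Moebius joins -/

section Joins

variable {J : Set ℝ} {p b : ℕ}

theorem isMoebiusJoin_cylinder {γ : ℝ → EuclideanSpace ℝ (Fin p)} (hJ : IsOpen J)
    (hγ : IsUnitSpeedEuclidean γ J) :
    IsMoebiusJoin 1 0 (fun s => inlL p b (γ s)) (fun _ => 1) (inrL p b) J Set.univ
      (curvatureEuclidean γ) (fun _ => 1) (fun _ => 1) := by
  have hD : ∀ x ∈ J ×ˢ (Set.univ : Set (EuclideanSpace ℝ (Fin b))), ∀ v,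
      joinMapDeriv 1 0 (fun s => inlL p b (γ s)) (fun _ => 1) (inrL p b) x v =
      v.1 • inlL p b (deriv γ x.1) + inrL p b v.2 := fun x hx v => by
    rw [joinMapDeriv_apply, deriv_clm_comp _ (differentiableAt_of_contDiffOn hJ hγ.1 hx.1),
      fderiv_clm]
    simp
  have hA : ContDiffOn ℝ ∞ (fun s => inlL p b (γ s)) J := (inlL p b).contDiff.comp_contDiffOn hγ.1
  have h11 : ∀ s ∈ J, ⟪deriv γ s, deriv γ s⟫ = 1 := fun s hs => by
    rw [real_inner_self_eq_norm_sq, hγ.2 s hs, one_pow]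
  refine ⟨hA, contDiffOn_const, (inrL p b).contDiff, fun _ _ => one_pos, fun x hx v w => ?_,
    fun x hx => ⟨0, inlL p b (deriv (deriv γ) x.1), fun v => inner_zero_right _, fun v => ?_, ?_,
      fun v w => ⟨0, ?_⟩⟩⟩
  · rw [hD x hx, hD x hx]
    simp only [inner_add_left, inner_add_right, inner_smul_left, inner_smul_right, inner_inlL_inlL,
      inner_inrL_inrL, inner_inlL_inrL, inner_inrL_inlL, RCLike.conj_to_real,
      h11 _ hx.1]
    ring
  · rw [hD x hx]
    simp only [inner_add_left, inner_smul_left, inner_inlL_inlL, inner_inrL_inlL,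
      inner_deriv_deriv_deriv_eq_zero hJ hγ.1 hγ.2 hx.1]
    simp
  · rw [one_mul, norm_eq_sqrt_real_inner, inner_inlL_inlL, ← norm_eq_sqrt_real_inner]
    rfl
  · rw [fderiv_fderiv_joinMap hJ hA contDiffOn_const (inrL p b).contDiff hx.1,
      deriv_deriv_clm_comp _ hJ hγ.1 hx.1, fderiv_fderiv_clm]
    simp

theorem isMoebiusJoin_generalizedCone {γ : ℝ → EuclideanSpace ℝ (Fin p)} (hJ : IsOpen J)
    (hγ : IsUnitSpeedSphere γ J) :
    IsMoebiusJoin 0 (EuclideanSpace.proj 0) (fun s => inlL p b (γ s)) (fun _ => 1)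
      (fun z => inrL p b (tailL b z)) J {z | 0 < z 0}
      (curvatureSphere γ) (fun x => x.2 0) (fun z => 1 / z 0 ^ 2) := by
  have hT : (fun z => inrL p b (tailL b z)) = ((inrL p b).comp (tailL b)) := rfl
  have hBc : ContDiff ℝ ∞ fun z => inrL p b (tailL b z) := ((inrL p b).comp (tailL b)).contDiff
  have hD : ∀ x ∈ J ×ˢ {z : EuclideanSpace ℝ (Fin (b + 1)) | 0 < z 0}, ∀ v,
      joinMapDeriv 0 (EuclideanSpace.proj 0) (fun s => inlL p b (γ s)) (fun _ => 1)
      (fun z => inrL p b (tailL b z)) x v =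
      (v.1 * x.2 0) • inlL p b (deriv γ x.1) + v.2 0 • inlL p b (γ x.1) +
        inrL p b (tailL b v.2) := fun x hx v => by
    rw [joinMapDeriv_apply, deriv_clm_comp _ (differentiableAt_of_contDiffOn hJ hγ.1 hx.1), hT,
      fderiv_clm]
    simp [smul_smul]
  have hA : ContDiffOn ℝ ∞ (fun s => inlL p b (γ s)) J := (inlL p b).contDiff.comp_contDiffOn hγ.1
  have hγγ : ∀ s ∈ J, ⟪γ s, γ s⟫ = 1 := fun s hs => by
    rw [real_inner_self_eq_norm_sq, hγ.2.1 s hs, one_pow]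
  have h11 : ∀ s ∈ J, ⟪deriv γ s, deriv γ s⟫ = 1 := fun s hs => by
    rw [real_inner_self_eq_norm_sq, hγ.2.2 s hs, one_pow]
  have h01 : ∀ s ∈ J, ⟪γ s, deriv γ s⟫ = 0 := fun s hs => by
    have hd := differentiableAt_of_contDiffOn hJ hγ.1 hs
    have := inner_deriv_add_of_inner_eq hJ hγγ hs hd hd (hasDerivAt_const s 1)
    linarith [real_inner_comm (γ s) (deriv γ s)]
  have h10 : ∀ s ∈ J, ⟪deriv γ s, γ s⟫ = 0 := fun s hs =>
    (real_inner_comm _ _).trans (h01 s hs)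
  refine ⟨hA, contDiffOn_const, hBc, fun x hx => hx.2,
    fun x hx v w => ?_, fun x hx => ⟨0, x.2 0 • inlL p b (deriv (deriv γ) x.1 -
      ⟪deriv (deriv γ) x.1, γ x.1⟫ • γ x.1), fun v => inner_zero_right _, fun v => ?_, ?_,
      fun v w => ?_⟩⟩
  · have hx0 : x.2 0 ≠ 0 := ne_of_gt hx.2
    rw [hD x hx, hD x hx, inner_eq_zero_add_tail v.2]
    simp only [inner_add_left, inner_add_right, inner_smul_left, inner_smul_right, inner_inlL_inlL,
      inner_inrL_inrL, inner_inlL_inrL, inner_inrL_inlL, RCLike.conj_to_real, hγγ _ hx.1,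
      h11 _ hx.1, h01 _ hx.1, h10 _ hx.1]
    field_simp
    ring
  · rw [hD x hx]
    simp only [map_sub, map_smul, inner_add_left, inner_sub_right, inner_smul_left,
      inner_smul_right, inner_inlL_inlL, inner_inrL_inlL, hγγ _ hx.1, h10 _ hx.1,
      inner_deriv_deriv_deriv_eq_zero hJ hγ.1 hγ.2.2 hx.1,
      real_inner_comm (deriv (deriv γ) x.1) (γ x.1), RCLike.conj_to_real]
    ring
  · have hx0 : 0 < x.2 0 := hx.2
    rw [norm_smul, Real.norm_of_nonneg hx0.le, norm_eq_sqrt_real_inner, inner_inlL_inlL,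
      ← norm_eq_sqrt_real_inner]
    rfl
  · have hx0 : x.2 0 ≠ 0 := ne_of_gt hx.2
    refine ⟨((x.2 0)⁻¹ * (v.1 * w.2 0 + w.1 * v.2 0),
      (v.1 * w.1 * x.2 0 * ⟪deriv (deriv γ) x.1, γ x.1⟫) • EuclideanSpace.single 0 1), ?_⟩
    rw [fderiv_fderiv_joinMap hJ hA contDiffOn_const hBc hx.1,
      deriv_deriv_clm_comp _ hJ hγ.1 hx.1, hT, fderiv_fderiv_clm, ← hT, hD x hx v, hD x hx w, hD x hx,
      deriv_clm_comp _ (differentiableAt_of_contDiffOn hJ hγ.1 hx.1)]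
    have htail : tailL b (EuclideanSpace.single 0 1) = 0 := by
      ext i
      simp [tailL_apply]
    simp only [map_smul, htail, map_sub]
    simp
    match_scalars <;> field_simp
    ring

end Joins

section Rotational

theorem hyperbolicMetric_apply {m : ℕ} (i : Fin m) (z v w : EuclideanSpace ℝ (Fin m)) :
    hyperbolicMetric i z v w = 1 / z i ^ 2 * ⟪v, w⟫ := rfl

set_option maxSynthPendingDepth 3 in
theorem christoffel_hyperbolicMetric {m : ℕ} (i : Fin m) {z : EuclideanSpace ℝ (Fin m)}
    (hz : 0 < z i) (v w : EuclideanSpace ℝ (Fin m)) :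
    christoffel (hyperbolicMetric i) z v w = (⟪v, w⟫ / z i) • EuclideanSpace.single i 1 -
      (v i / z i) • w - (w i / z i) • v := by
  have hfd : ∀ v w y, fderiv ℝ (hyperbolicMetric i) z v w y = -2 * v i / z i ^ 3 * ⟪w, y⟫ := by
    intro v w y
    obtain ⟨b, hbG, hb⟩ : ∃ b : EuclideanSpace ℝ (Fin m) →L[ℝ] EuclideanSpace ℝ (Fin m) →L[ℝ] ℝ,
        (hyperbolicMetric i = fun z => (1 / z i ^ 2) • b) ∧ ∀ v w, b v w = ⟪v, w⟫ :=
      ⟨innerSL ℝ, rfl, fun _ _ => rfl⟩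
    rw [hbG, (((isSpaceFormFactor_hyperbolic m i).hasFDerivAt z hz).smul_const b).fderiv]
    simp [hb, EuclideanSpace.inner_single_left]
    field_simp
  refine christoffel_eq_of (injective_of_apply_self_ne_zero fun v hv => ?_) fun y => ?_
  · rw [hyperbolicMetric_apply, real_inner_self_eq_norm_sq]
    have := norm_pos_iff.2 hv
    positivity
  · have hz0 := hz.ne'
    rw [hfd, hfd, hfd, hyperbolicMetric_apply]
    simp only [inner_sub_left, inner_smul_left, RCLike.conj_to_real,
      EuclideanSpace.inner_single_left, map_one, one_mul]
    field_simp
    ring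

variable {J : Set ℝ} {p b : ℕ} {V : Type*} [NormedAddCommGroup V] [InnerProductSpace ℝ V]

/-- The covariant acceleration of a curve in the half-space model of hyperbolic space. -/
theorem covariantAcceleration_hyperbolic {m : ℕ} {i : Fin m} {γ : ℝ → EuclideanSpace ℝ (Fin m)}
    (hγ : IsUnitSpeedHyperbolic i γ J) {s : ℝ} (hs : s ∈ J) :
    covariantAcceleration (hyperbolicMetric i) γ s = deriv (deriv γ) s +
      γ s i • EuclideanSpace.single i 1 - (2 * (deriv γ s i / γ s i)) • deriv γ s := by
  have h0 := hγ.2.1 s hs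
  have h1 := hγ.2.2 s hs
  rw [hyperbolicMetric_apply, one_div, inv_mul_eq_one₀ (pow_ne_zero 2 h0.ne')] at h1
  rw [covariantAcceleration, christoffel_hyperbolicMetric i h0, ← h1,
    show γ s i ^ 2 / γ s i = γ s i by field_simp]
  module

theorem curvatureHyperbolic_eq {m : ℕ} {i : Fin m} {γ : ℝ → EuclideanSpace ℝ (Fin m)}
    (hγ : IsUnitSpeedHyperbolic i γ J) {s : ℝ} (hs : s ∈ J) :
    curvatureHyperbolic i γ s = ‖deriv (deriv γ) s +
      γ s i • EuclideanSpace.single i 1 - (2 * (deriv γ s i / γ s i)) • deriv γ s‖ / γ s i := by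
  have h0 := hγ.2.1 s hs
  rw [curvatureHyperbolic, covariantAcceleration_hyperbolic hγ hs, hyperbolicMetric_apply,
    real_inner_self_eq_norm_sq, Real.sqrt_eq_iff_mul_self_eq (by positivity) (by positivity)]
  field_simp

theorem isMoebiusJoin_rotational {γ : ℝ → EuclideanSpace ℝ (Fin (p + 1))} (hJ : IsOpen J)
    (hγ : IsUnitSpeedHyperbolic (Fin.last p) γ J) {B : V → EuclideanSpace ℝ (Fin b)} {L : V → ℝ}
    (hB : IsConformalSphereMap B L) :
    IsMoebiusJoin 1 0 (fun s => inlL p b (initL p (γ s))) (fun s => γ s (Fin.last p))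
      (fun u => inrL p b (B u)) J Set.univ (curvatureHyperbolic (Fin.last p) γ)
      (fun x => γ x.1 (Fin.last p)) L := by
  have hA : ContDiffOn ℝ ∞ (fun s => inlL p b (initL p (γ s))) J :=
    ((inlL p b).comp (initL p)).contDiff.comp_contDiffOn hγ.1
  have hn : ContDiffOn ℝ ∞ (fun s => γ s (Fin.last p)) J :=
    (EuclideanSpace.proj (𝕜 := ℝ) (Fin.last p)).contDiff.comp_contDiffOn hγ.1
  have hBc : ContDiff ℝ ∞ fun u => inrL p b (B u) := (inrL p b).contDiff.comp hB.contDiff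
  have hA1 : ∀ s ∈ J, deriv (fun s => inlL p b (initL p (γ s))) s =
      inlL p b (initL p (deriv γ s)) := fun s hs =>
    deriv_clm_comp ((inlL p b).comp (initL p)) (differentiableAt_of_contDiffOn hJ hγ.1 hs)
  have hA2 : ∀ s ∈ J, deriv (deriv fun s => inlL p b (initL p (γ s))) s =
      inlL p b (initL p (deriv (deriv γ) s)) := fun s hs =>
    deriv_deriv_clm_comp ((inlL p b).comp (initL p)) hJ hγ.1 hs
  have hn1 : ∀ s ∈ J, deriv (fun s => γ s (Fin.last p)) s = deriv γ s (Fin.last p) := fun s hs =>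
    deriv_clm_comp (EuclideanSpace.proj (𝕜 := ℝ) (Fin.last p))
      (differentiableAt_of_contDiffOn hJ hγ.1 hs)
  have hn2 : ∀ s ∈ J, deriv (deriv fun s => γ s (Fin.last p)) s =
      deriv (deriv γ) s (Fin.last p) := fun s hs =>
    deriv_deriv_clm_comp (EuclideanSpace.proj (𝕜 := ℝ) (Fin.last p)) hJ hγ.1 hs
  have hBd : ∀ u v, fderiv ℝ (fun u => inrL p b (B u)) u v = inrL p b (fderiv ℝ B u v) :=
    fun u v => fderiv_clm_comp _ (hB.contDiff.differentiable (by simp) u) v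
  have hD : ∀ x ∈ J ×ˢ (Set.univ : Set V), ∀ v,
      joinMapDeriv 1 0 (fun s => inlL p b (initL p (γ s))) (fun s => γ s (Fin.last p))
        (fun u => inrL p b (B u)) x v =
      v.1 • (inlL p b (initL p (deriv γ x.1)) + deriv γ x.1 (Fin.last p) • inrL p b (B x.2)) +
        γ x.1 (Fin.last p) • inrL p b (fderiv ℝ B x.2 v.2) := fun x hx v => by
    rw [joinMapDeriv_apply, hA1 _ hx.1, hn1 _ hx.1, hBd]
    simp
  have hsq : ∀ s ∈ J, ⟪deriv γ s, deriv γ s⟫ = γ s (Fin.last p) ^ 2 := fun s hs => by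
    have h1 := hγ.2.2 s hs
    rw [hyperbolicMetric_apply, one_div,
      inv_mul_eq_one₀ (pow_ne_zero 2 (hγ.2.1 s hs).ne')] at h1
    exact h1.symm
  have hsp : ∀ s ∈ J, ⟪initL p (deriv γ s), initL p (deriv γ s)⟫ =
      γ s (Fin.last p) ^ 2 - deriv γ s (Fin.last p) ^ 2 := fun s hs => by
    rw [← hsq s hs, inner_eq_init_add_last]
    ring
  have hacc : ∀ s ∈ J, ⟪initL p (deriv γ s), initL p (deriv (deriv γ) s)⟫ =
      γ s (Fin.last p) * deriv γ s (Fin.last p) -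
        deriv γ s (Fin.last p) * deriv (deriv γ) s (Fin.last p) := fun s hs => by
    have hd := differentiableAt_deriv_of_contDiffOn hJ hγ.1 hs
    have hl : HasDerivAt (fun s => γ s (Fin.last p)) (deriv γ s (Fin.last p)) s := by
      rw [← hn1 s hs]
      exact (differentiableAt_of_contDiffOn hJ hn hs).hasDerivAt
    have h := inner_deriv_add_of_inner_eq hJ hsq hs hd hd (hl.pow 2)
    rw [real_inner_comm (deriv γ s) (deriv (deriv γ) s), inner_eq_init_add_last] at h
    simp at h
    linarith
  have hBs : ∀ u v, ⟪B u, fderiv ℝ B u v⟫ = 0 := fun u v =>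
    (real_inner_comm _ _).trans (hB.inner_fderiv_self u v)
  have hinit : initL p (EuclideanSpace.single (Fin.last p) 1) = 0 := by
    ext i
    simp [initL_apply]
  refine ⟨hA, hn, hBc, fun x hx => hγ.2.1 _ hx.1, fun x hx v w => ?_, fun x hx => ?_⟩
  · rw [hD x hx, hD x hx]
    simp only [inner_add_left, inner_add_right, inner_smul_left, inner_smul_right,
      inner_inlL_inlL, inner_inrL_inrL, inner_inlL_inrL, inner_inrL_inlL, RCLike.conj_to_real,
      hB.inner_self, hB.inner_fderiv_self, hB.inner_fderiv, hBs, hsp _ hx.1]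
    ring
  · have h0 : γ x.1 (Fin.last p) ≠ 0 := (hγ.2.1 _ hx.1).ne'
    set h := γ x.1 (Fin.last p) with hh
    set h' := deriv γ x.1 (Fin.last p) with hh'
    set h'' := deriv (deriv γ) x.1 (Fin.last p) with hh''
    set a := deriv (deriv γ) x.1 + h • EuclideanSpace.single (Fin.last p) 1 -
      (2 * (h' / h)) • deriv γ x.1 with ha
    have ha0 : initL p a = initL p (deriv (deriv γ) x.1) - (2 * (h' / h)) • initL p (deriv γ x.1) := by
      rw [ha, map_sub, map_add, map_smul, map_smul, hinit, smul_zero, add_zero]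
    have hal : a (Fin.last p) = h'' + h - 2 * (h' / h) * h' := by
      simp [ha, hh', hh'']
    have hDx := hD x hx
    refine ⟨(-1 / h) • (inrL p b (B x.2) - (h' / h ^ 2) • (inlL p b (initL p (deriv γ x.1)) +
      h' • inrL p b (B x.2))), inlL p b (initL p a) + a (Fin.last p) • inrL p b (B x.2),
      fun v => ?_, fun v => ?_, ?_, fun v w => ?_⟩
    · rw [hDx]
      simp only [inner_add_left, inner_add_right, inner_sub_right, inner_smul_left,
        inner_smul_right, inner_inlL_inlL, inner_inrL_inrL, inner_inlL_inrL, inner_inrL_inlL,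
        RCLike.conj_to_real, hB.inner_self, hB.inner_fderiv_self, hsp _ hx.1]
      field_simp
      ring
    · rw [hDx, ha0, hal]
      simp only [map_sub, map_smul, inner_add_left, inner_add_right, inner_sub_right,
        inner_smul_left, inner_smul_right, inner_inlL_inlL, inner_inrL_inrL, inner_inlL_inrL,
        inner_inrL_inlL, RCLike.conj_to_real, hB.inner_self, hB.inner_fderiv_self, hsp _ hx.1,
        hacc _ hx.1]
      field_simp
      ring
    · rw [curvatureHyperbolic_eq hγ hx.1, mul_div_cancel₀ _ h0, norm_eq_sqrt_real_inner,
        norm_eq_sqrt_real_inner, inner_eq_init_add_last]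
      congr 1
      simp only [inner_add_left, inner_add_right, inner_smul_left, inner_smul_right,
        inner_inlL_inlL, inner_inrL_inrL, inner_inlL_inrL, inner_inrL_inlL, RCLike.conj_to_real,
        hB.inner_self]
      ring
    · obtain ⟨t, ht⟩ := hB.fderiv_fderiv x.2 v.2 w.2
      refine ⟨(h' / h * (v.1 * w.1 - L x.2 * ⟪v.2, w.2⟫),
        t + (h' / h) • (v.1 • w.2 + w.1 • v.2)), ?_⟩
      rw [fderiv_fderiv_joinMap hJ hA hn hBc hx.1, hA2 _ hx.1, hn2 _ hx.1, hn1 _ hx.1, hBd, hBd,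
        fderiv_fderiv_clm_comp _ hB.contDiff, ht, hDx v, hDx w, hDx, ha0, hal]
      simp only [inner_add_left, inner_add_right, inner_smul_left, inner_smul_right,
        inner_inlL_inlL, inner_inrL_inrL, inner_inlL_inrL, inner_inrL_inlL, RCLike.conj_to_real,
        hB.inner_self, hB.inner_fderiv_self, hB.inner_fderiv, hBs, hsp _ hx.1, map_add, map_sub,
        map_smul, zero_apply]
      simp only [← hh, ← hh', ← hh'']
      match_scalars <;> field_simp <;> ring

end Rotational

/-! ## The geometry of the three types of immersions -/

section Curvature

variable {J : Set ℝ} {m : ℕ} {γ : ℝ → EuclideanSpace ℝ (Fin m)}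

theorem contDiffOn_curvatureEuclidean (hJ : IsOpen J) (hγ : IsUnitSpeedEuclidean γ J)
    (hκ : ∀ s ∈ J, 0 < curvatureEuclidean γ s) : ContDiffOn ℝ ∞ (curvatureEuclidean γ) J :=
  (contDiffOn_deriv hJ (contDiffOn_deriv hJ hγ.1)).norm ℝ fun s hs => norm_pos_iff.1 (hκ s hs)

theorem contDiffOn_curvatureSphere (hJ : IsOpen J) (hγ : IsUnitSpeedSphere γ J)
    (hκ : ∀ s ∈ J, 0 < curvatureSphere γ s) : ContDiffOn ℝ ∞ (curvatureSphere γ) J := by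
  have h2 := contDiffOn_deriv hJ (contDiffOn_deriv hJ hγ.1)
  exact (h2.sub ((h2.inner ℝ hγ.1).smul hγ.1)).norm ℝ fun s hs => norm_pos_iff.1 (hκ s hs)

theorem contDiffOn_curvatureHyperbolic {i : Fin m} (hJ : IsOpen J)
    (hγ : IsUnitSpeedHyperbolic i γ J) (hκ : ∀ s ∈ J, 0 < curvatureHyperbolic i γ s) :
    ContDiffOn ℝ ∞ (curvatureHyperbolic i γ) J := by
  have h1 := contDiffOn_deriv hJ hγ.1
  have hi : ∀ {δ : ℝ → EuclideanSpace ℝ (Fin m)}, ContDiffOn ℝ ∞ δ J →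
      ContDiffOn ℝ ∞ (fun s => δ s i) J := fun hδ =>
    (EuclideanSpace.proj (𝕜 := ℝ) i).contDiff.comp_contDiffOn hδ
  have h0 : ∀ s ∈ J, γ s i ≠ 0 := fun s hs => (hγ.2.1 s hs).ne'
  refine ContDiffOn.congr (ContDiffOn.div (ContDiffOn.norm ℝ
    (((contDiffOn_deriv hJ h1).add ((hi hγ.1).smul contDiffOn_const)).sub
      ((contDiffOn_const.mul ((hi h1).div (hi hγ.1) h0)).smul h1)) fun s hs h => ?_) (hi hγ.1) h0)
    fun s hs => curvatureHyperbolic_eq hγ hs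
  have := hκ s hs
  rw [curvatureHyperbolic_eq hγ hs] at this
  exact (div_pos_iff_of_pos_right (hγ.2.1 s hs)).1 this |>.ne' (norm_eq_zero.2 h)

end Curvature

section Immersions

variable {J : Set ℝ} {a d : ℕ} {c : ℝ}

theorem solvesCurvatureEquations_regularity {κ : ℝ → ℝ} (hJo : IsOpen J)
    (hκs : ContDiffOn ℝ ∞ κ J) (hκ : ∀ s ∈ J, 0 < κ s) :
    (∀ s ∈ J, DifferentiableAt ℝ κ⁻¹ s) ∧ ∀ s ∈ J, DifferentiableAt ℝ (deriv κ⁻¹) s :=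
  have h := contDiffOn_inv_curvature hκs hκ
  ⟨fun _ hs => differentiableAt_of_contDiffOn hJo h hs,
    fun _ hs => differentiableAt_deriv_of_contDiffOn hJo h hs⟩

theorem cylinder_geometry (hd : 1 ≤ d) (hJo : IsOpen J) (hJc : J.OrdConnected) (hJn : J.Nonempty)
    {γ : ℝ → EuclideanSpace ℝ (Fin a)} (hγ : IsUnitSpeedEuclidean γ J)
    (hκ : ∀ s ∈ J, 0 < curvatureEuclidean γ s) :
    IsImmersionOn 𝓘(ℝ, ℝ × EuclideanSpace ℝ (Fin (d + 1))) (cylinder (b := d + 1) γ) (J ×ˢ Set.univ) ∧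
      IsUmbilicFreeOn 𝓘(ℝ, ℝ × EuclideanSpace ℝ (Fin (d + 1))) (cylinder (b := d + 1) γ) (J ×ˢ Set.univ) ∧
      (∀ s ∈ J, ∀ u : EuclideanSpace ℝ (Fin (d + 1)), ∀ v w : ℝ × EuclideanSpace ℝ (Fin (d + 1)),
        moebiusMetric 𝓘(ℝ, ℝ × EuclideanSpace ℝ (Fin (d + 1))) (cylinder (b := d + 1) γ) (s, u) v w =
          curvatureEuclidean γ s ^ 2 * (v.1 * w.1 + ⟪v.2, w.2⟫)) ∧
      (HasConstantCurvatureOn 𝓘(ℝ, ℝ × EuclideanSpace ℝ (Fin (d + 1)))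
          (moebiusMetric 𝓘(ℝ, ℝ × EuclideanSpace ℝ (Fin (d + 1))) (cylinder (b := d + 1) γ))
          (J ×ˢ Set.univ) c ↔
        (c = 0 ∧ ∃ r : ℝ, 0 < r ∧ ∀ s ∈ J, curvatureEuclidean γ s = 1 / r) ∨
        (c < 0 ∧ IsUpToArcLength (curvatureEuclidean γ) J
          (fun t => 1 / (√(-c) * t)) (Set.Ioi 0))) := by
  have hκs := contDiffOn_curvatureEuclidean hJo hγ hκ
  have hM := isMoebiusJoin_cylinder (b := d + 1) hJo hγ
  have hfin : 2 ≤ Module.finrank ℝ (EuclideanSpace ℝ (Fin (d + 1))) := by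
    rw [finrank_euclideanSpace_fin]
    lia
  obtain ⟨hu1, hu2⟩ := solvesCurvatureEquations_regularity hJo hκs hκ
  obtain ⟨h1, h2, h3, h4⟩ := moebius_geometry_of_isMoebiusJoin
    𝓘(ℝ, ℝ × EuclideanSpace ℝ (Fin (d + 1))) (f := cylinder (b := d + 1) γ)
    (U := J ×ˢ Set.univ) (c := c) hfin hJo hκs hκ (isSpaceFormFactor_one _) (hJo.prod isOpen_univ)
    (by
      rw [contMDiffOn_iff_contDiffOn, cylinder_eq_joinMap]
      exact contDiffOn_joinMap hM.contDiffOn_left hM.contDiffOn_coeff hM.contDiff_right)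
    (fun x hx => hx) (fun s hs => ⟨(s, 0), ⟨hs, trivial⟩, rfl⟩)
    (fun x hx => ⟨_, cylinder_eq_joinMap γ, hM⟩) (fun x hx => .of_forall fun y => ⟨rfl, rfl⟩)
  refine ⟨h1, h2, fun s hs u v w => ?_, ?_⟩
  · rw [h3 (s, u) ⟨hs, trivial⟩, one_mul]
    rfl
  · rw [h4, solvesCurvatureEquations_zero_iff hJo hJc hJn hκ hu1 hu2]

theorem generalizedCone_geometry (hd : 1 ≤ d) (hJo : IsOpen J) (hJc : J.OrdConnected)
    (hJn : J.Nonempty) {γ : ℝ → EuclideanSpace ℝ (Fin a)} (hγ : IsUnitSpeedSphere γ J)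
    (hκ : ∀ s ∈ J, 0 < curvatureSphere γ s) :
    IsImmersionOn 𝓘(ℝ, ℝ × EuclideanSpace ℝ (Fin (d + 1))) (generalizedCone (b := d) γ)
        (J ×ˢ {z | 0 < z 0}) ∧
      IsUmbilicFreeOn 𝓘(ℝ, ℝ × EuclideanSpace ℝ (Fin (d + 1))) (generalizedCone (b := d) γ)
        (J ×ˢ {z | 0 < z 0}) ∧
      (∀ s ∈ J, ∀ z : EuclideanSpace ℝ (Fin (d + 1)), 0 < z 0 →
        ∀ v w : ℝ × EuclideanSpace ℝ (Fin (d + 1)),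
        moebiusMetric 𝓘(ℝ, ℝ × EuclideanSpace ℝ (Fin (d + 1))) (generalizedCone (b := d) γ) (s, z) v w =
          curvatureSphere γ s ^ 2 * (v.1 * w.1 + hyperbolicMetric 0 z v.2 w.2)) ∧
      (HasConstantCurvatureOn 𝓘(ℝ, ℝ × EuclideanSpace ℝ (Fin (d + 1)))
          (moebiusMetric 𝓘(ℝ, ℝ × EuclideanSpace ℝ (Fin (d + 1))) (generalizedCone (b := d) γ))
          (J ×ˢ {z | 0 < z 0}) c ↔
        c < 0 ∧ IsUpToArcLength (curvatureSphere γ) J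
          (fun t => 1 / (√(-c) * Real.sin t)) (Set.Ioo 0 Real.pi)) := by
  have hκs := contDiffOn_curvatureSphere hJo hγ hκ
  have hM := isMoebiusJoin_generalizedCone (b := d) hJo hγ
  have hfin : 2 ≤ Module.finrank ℝ (EuclideanSpace ℝ (Fin (d + 1))) := by
    rw [finrank_euclideanSpace_fin]
    lia
  have hL := isSpaceFormFactor_hyperbolic (d + 1) 0
  obtain ⟨hu1, hu2⟩ := solvesCurvatureEquations_regularity hJo hκs hκ
  obtain ⟨h1, h2, h3, h4⟩ := moebius_geometry_of_isMoebiusJoin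
    𝓘(ℝ, ℝ × EuclideanSpace ℝ (Fin (d + 1))) (f := generalizedCone (b := d) γ)
    (U := J ×ˢ {z | 0 < z 0}) (c := c) hfin hJo hκs hκ hL (hJo.prod hL.isOpen)
    (by
      rw [contMDiffOn_iff_contDiffOn, generalizedCone_eq_joinMap]
      exact (contDiffOn_joinMap hM.contDiffOn_left hM.contDiffOn_coeff hM.contDiff_right).mono
        (Set.prod_mono_right (Set.subset_univ _)))
    (fun x hx => hx) (fun s hs => ⟨(s, hL.nonempty.some), ⟨hs, hL.nonempty.some_mem⟩, rfl⟩)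
    (fun x hx => ⟨_, generalizedCone_eq_joinMap γ, hM⟩) (fun x hx => .of_forall fun y => ⟨rfl, rfl⟩)
  exact ⟨h1, h2, fun s hs z hz v w => h3 (s, z) ⟨hs, hz⟩ v w,
    h4.trans (solvesCurvatureEquations_neg_one_iff hJo hJc hJn hκ hu1 hu2)⟩

end Immersions

section Sphere

variable {b : ℕ}

/-- The inverse of the preferred chart of the unit sphere at a point. -/
def sphereParam (y : Metric.sphere (0 : EuclideanSpace ℝ (Fin (b + 1))) 1)
    (u : EuclideanSpace ℝ (Fin b)) : EuclideanSpace ℝ (Fin (b + 1)) :=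
  ((extChartAt (𝓡 b) y).symm u : Metric.sphere (0 : EuclideanSpace ℝ (Fin (b + 1))) 1)

theorem isConformalSphereMap_sphereParam
    (y : Metric.sphere (0 : EuclideanSpace ℝ (Fin (b + 1))) 1) :
    IsConformalSphereMap (sphereParam y) fun u => 16 * ((‖u‖ ^ 2 + 4)⁻¹) ^ 2 := by
  have : Fact (Module.finrank ℝ (EuclideanSpace ℝ (Fin (b + 1))) = b + 1) := ⟨by simp⟩
  let U := (OrthonormalBasis.fromOrthogonalSpanSingleton (𝕜 := ℝ) b
    (ne_zero_of_mem_unit_sphere (-y))).repr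
  let T : EuclideanSpace ℝ (Fin b) →ₗᵢ[ℝ] EuclideanSpace ℝ (Fin (b + 1)) :=
    (Submodule.subtypeₗᵢ _).comp U.symm.toLinearIsometry
  have hT : ∀ u, ⟪T u, ((-y : Metric.sphere (0 : EuclideanSpace ℝ (Fin (b + 1))) 1) :
      EuclideanSpace ℝ (Fin (b + 1)))⟫ = 0 := fun u => by
    rw [real_inner_comm]
    exact Submodule.mem_orthogonal_singleton_iff_inner_right.1 (U.symm u).2
  have h := isConformalSphereMap_stereographic T (norm_eq_of_mem_sphere (-y)) hT
  convert h using 1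
  funext u
  have := stereographic'_symm_apply (n := b) (-y) u
  refine this.trans ?_
  have hn : ‖(U.symm u : EuclideanSpace ℝ (Fin (b + 1)))‖ = ‖u‖ := T.norm_map u
  simp only
  rw [hn, ← smul_add]
  rfl

theorem sphereMetric_apply (y : Metric.sphere (0 : EuclideanSpace ℝ (Fin (b + 1))) 1)
    (v w : EuclideanSpace ℝ (Fin b)) :
    sphereMetric y v w = 16 * ((‖extChartAt (𝓡 b) y y‖ ^ 2 + 4)⁻¹) ^ 2 * ⟪v, w⟫ := by
  have : Fact (Module.finrank ℝ (EuclideanSpace ℝ (Fin (b + 1))) = b + 1) := ⟨by simp⟩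
  have hd := (contMDiff_coe_sphere (E := EuclideanSpace ℝ (Fin (b + 1))) (m := 1) (n := b)
    y).mdifferentiableAt (by simp)
  exact (inducedForm_apply (𝓡 b) hd v w).trans
    ((isConformalSphereMap_sphereParam y).inner_fderiv _ v w)

end Sphere

section Rotational

variable {J : Set ℝ} {p d : ℕ} {c : ℝ}

theorem rotational_geometry (hd : 1 ≤ d) (hJo : IsOpen J) (hJc : J.OrdConnected)
    (hJn : J.Nonempty) {γ : ℝ → EuclideanSpace ℝ (Fin (p + 1))}
    (hγ : IsUnitSpeedHyperbolic (Fin.last p) γ J)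
    (hκ : ∀ s ∈ J, 0 < curvatureHyperbolic (Fin.last p) γ s) :
    IsImmersionOn (𝓘(ℝ, ℝ).prod (𝓡 (d + 1))) (rotational (b := d + 2) γ) (J ×ˢ Set.univ) ∧
      IsUmbilicFreeOn (𝓘(ℝ, ℝ).prod (𝓡 (d + 1))) (rotational (b := d + 2) γ) (J ×ˢ Set.univ) ∧
      (∀ s ∈ J, ∀ y : Metric.sphere (0 : EuclideanSpace ℝ (Fin (d + 2))) 1,
        ∀ v w : ℝ × EuclideanSpace ℝ (Fin (d + 1)),
        moebiusMetric (𝓘(ℝ, ℝ).prod (𝓡 (d + 1))) (rotational (b := d + 2) γ) (s, y) v w =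
          curvatureHyperbolic (Fin.last p) γ s ^ 2 * (v.1 * w.1 + sphereMetric y v.2 w.2)) ∧
      (HasConstantCurvatureOn (𝓘(ℝ, ℝ).prod (𝓡 (d + 1)))
          (moebiusMetric (𝓘(ℝ, ℝ).prod (𝓡 (d + 1))) (rotational (b := d + 2) γ))
          (J ×ˢ Set.univ) c ↔
        (0 < c ∧ IsUpToArcLength (curvatureHyperbolic (Fin.last p) γ) J
          (fun t => 1 / (√c * Real.cosh t)) Set.univ) ∨
        (c < 0 ∧ IsUpToArcLength (curvatureHyperbolic (Fin.last p) γ) J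
          (fun t => 1 / (√(-c) * Real.sinh t)) (Set.Ioi 0)) ∨
        (c = 0 ∧ IsUpToArcLength (curvatureHyperbolic (Fin.last p) γ) J
          Real.exp Set.univ)) := by
  have hκs := contDiffOn_curvatureHyperbolic hJo hγ hκ
  have hfin : 2 ≤ Module.finrank ℝ (EuclideanSpace ℝ (Fin (d + 1))) := by
    rw [finrank_euclideanSpace_fin]
    lia
  obtain ⟨hu1, hu2⟩ := solvesCurvatureEquations_regularity hJo hκs hκ
  have : Fact (Module.finrank ℝ (EuclideanSpace ℝ (Fin (d + 2))) = d + 1 + 1) := ⟨by simp⟩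
  have hfst : ∀ x : ℝ × Metric.sphere (0 : EuclideanSpace ℝ (Fin (d + 2))) 1,
      extChartAt (𝓘(ℝ, ℝ).prod (𝓡 (d + 1))) x x = (x.1, extChartAt (𝓡 (d + 1)) x.2 x.2) :=
    fun x => by rw [extChartAt_prod]; rfl
  have hsymm : ∀ (x : ℝ × Metric.sphere (0 : EuclideanSpace ℝ (Fin (d + 2))) 1)
      (y : ℝ × EuclideanSpace ℝ (Fin (d + 1))),
      (extChartAt (𝓘(ℝ, ℝ).prod (𝓡 (d + 1))) x).symm y =
        (y.1, (extChartAt (𝓡 (d + 1)) x.2).symm y.2) :=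
    fun x y => by rw [extChartAt_prod]; rfl
  have hf : ContMDiffOn (𝓘(ℝ, ℝ).prod (𝓡 (d + 1))) 𝓘(ℝ, EuclideanSpace ℝ (Fin p ⊕ Fin (d + 2))) ∞
      (rotational (b := d + 2) γ) (J ×ˢ Set.univ) := by
    have h1 : ContMDiffOn (𝓘(ℝ, ℝ).prod (𝓡 (d + 1))) 𝓘(ℝ, EuclideanSpace ℝ (Fin (p + 1))) ∞
        (fun x : ℝ × Metric.sphere (0 : EuclideanSpace ℝ (Fin (d + 2))) 1 => γ x.1)
        (J ×ˢ Set.univ) :=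
      hγ.1.contMDiffOn.comp contMDiffOn_fst fun x hx => hx.1
    have h2 : ContMDiff (𝓘(ℝ, ℝ).prod (𝓡 (d + 1))) 𝓘(ℝ, EuclideanSpace ℝ (Fin (d + 2))) ∞
        (fun x : ℝ × Metric.sphere (0 : EuclideanSpace ℝ (Fin (d + 2))) 1 =>
          (x.2 : EuclideanSpace ℝ (Fin (d + 2)))) :=
      contMDiff_coe_sphere.comp contMDiff_snd
    have h3 := (((inlL p (d + 2)).comp (initL p)).contMDiff (n := ∞)).comp_contMDiffOn h1
    have h4 := ((EuclideanSpace.proj (𝕜 := ℝ) (Fin.last p)).contMDiff (n := ∞)).comp_contMDiffOn h1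
    have h5 := ((inrL p (d + 2)).contMDiff (n := ∞)).comp h2
    exact (h3.add (h4.smul h5.contMDiffOn)).congr fun x _ => rotational_eq γ x
  obtain ⟨h1, h2, h3, h4⟩ := moebius_geometry_of_isMoebiusJoin
    (𝓘(ℝ, ℝ).prod (𝓡 (d + 1))) (f := rotational (b := d + 2) γ)
    (U := J ×ˢ Set.univ) (c := c) hfin hJo hκs hκ (isSpaceFormFactor_sphere _)
    (hJo.prod isOpen_univ) hf
    (fun x hx => by rw [hfst]; exact ⟨hx.1, trivial⟩)
    (fun s hs => ⟨(s, ⟨EuclideanSpace.single 0 1, by simp⟩), ⟨hs, trivial⟩, by rw [hfst]⟩)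
    (fun x hx => ⟨_, funext fun y => by
      rw [chartExpr, Function.comp_apply, hsymm, rotational_eq, joinMap]
      simp only [zero_apply, add_zero, one_smul]
      rfl,
      isMoebiusJoin_rotational hJo hγ (isConformalSphereMap_sphereParam x.2)⟩)
    (fun x hx => .of_forall fun y => by
      rw [hfst, hsymm]
      exact ⟨rfl, rfl⟩)
  refine ⟨h1, h2, fun s hs y v w => ?_,
    h4.trans (solvesCurvatureEquations_one_iff hJo hJc hJn hκ hu1 hu2)⟩
  rw [h3 (s, y) ⟨hs, trivial⟩, hfst, sphereMetric_apply]

end Rotational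

end MoebiusGeom

end

open MoebiusGeom in
theorem mainTheorem10 (d p : ℕ) (hd : 1 ≤ d) (hp : 1 ≤ p) (c : ℝ)
    (J : Set ℝ) (hJo : IsOpen J) (hJc : J.OrdConnected) (hJn : J.Nonempty) :
    -- cylinders over curves in Euclidean space
    (∀ γ : ℝ → EuclideanSpace ℝ (Fin (p + 1)), IsUnitSpeedEuclidean γ J →
      (∀ s ∈ J, 0 < curvatureEuclidean γ s) →
      IsImmersionOn 𝓘(ℝ, ℝ × EuclideanSpace ℝ (Fin (d + 1))) (cylinder (b := d + 1) γ) (J ×ˢ Set.univ) ∧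
      IsUmbilicFreeOn 𝓘(ℝ, ℝ × EuclideanSpace ℝ (Fin (d + 1))) (cylinder (b := d + 1) γ) (J ×ˢ Set.univ) ∧
      (∀ s ∈ J, ∀ u : EuclideanSpace ℝ (Fin (d + 1)), ∀ v w : ℝ × EuclideanSpace ℝ (Fin (d + 1)),
        moebiusMetric 𝓘(ℝ, ℝ × EuclideanSpace ℝ (Fin (d + 1))) (cylinder (b := d + 1) γ) (s, u) v w =
          curvatureEuclidean γ s ^ 2 * (v.1 * w.1 + ⟪v.2, w.2⟫)) ∧
      (HasConstantCurvatureOn 𝓘(ℝ, ℝ × EuclideanSpace ℝ (Fin (d + 1)))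
          (moebiusMetric 𝓘(ℝ, ℝ × EuclideanSpace ℝ (Fin (d + 1))) (cylinder (b := d + 1) γ))
          (J ×ˢ Set.univ) c ↔
        (c = 0 ∧ ∃ r : ℝ, 0 < r ∧ ∀ s ∈ J, curvatureEuclidean γ s = 1 / r) ∨
        (c < 0 ∧ IsUpToArcLength (curvatureEuclidean γ) J
          (fun t => 1 / (√(-c) * t)) (Set.Ioi 0)))) ∧
    -- generalized cones over curves in the sphere
    (∀ γ : ℝ → EuclideanSpace ℝ (Fin (p + 2)), IsUnitSpeedSphere γ J →
      (∀ s ∈ J, 0 < curvatureSphere γ s) →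
      IsImmersionOn 𝓘(ℝ, ℝ × EuclideanSpace ℝ (Fin (d + 1))) (generalizedCone (b := d) γ)
        (J ×ˢ {z | 0 < z 0}) ∧
      IsUmbilicFreeOn 𝓘(ℝ, ℝ × EuclideanSpace ℝ (Fin (d + 1))) (generalizedCone (b := d) γ)
        (J ×ˢ {z | 0 < z 0}) ∧
      (∀ s ∈ J, ∀ z : EuclideanSpace ℝ (Fin (d + 1)), 0 < z 0 →
        ∀ v w : ℝ × EuclideanSpace ℝ (Fin (d + 1)),
        moebiusMetric 𝓘(ℝ, ℝ × EuclideanSpace ℝ (Fin (d + 1))) (generalizedCone (b := d) γ) (s, z) v w =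
          curvatureSphere γ s ^ 2 * (v.1 * w.1 + hyperbolicMetric 0 z v.2 w.2)) ∧
      (HasConstantCurvatureOn 𝓘(ℝ, ℝ × EuclideanSpace ℝ (Fin (d + 1)))
          (moebiusMetric 𝓘(ℝ, ℝ × EuclideanSpace ℝ (Fin (d + 1))) (generalizedCone (b := d) γ))
          (J ×ˢ {z | 0 < z 0}) c ↔
        c < 0 ∧ IsUpToArcLength (curvatureSphere γ) J
          (fun t => 1 / (√(-c) * Real.sin t)) (Set.Ioo 0 Real.pi))) ∧
    -- rotational submanifolds over curves in hyperbolic space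
    (∀ γ : ℝ → EuclideanSpace ℝ (Fin (p + 1)), IsUnitSpeedHyperbolic (Fin.last p) γ J →
      (∀ s ∈ J, 0 < curvatureHyperbolic (Fin.last p) γ s) →
      IsImmersionOn (𝓘(ℝ, ℝ).prod (𝓡 (d + 1))) (rotational (b := d + 2) γ) (J ×ˢ Set.univ) ∧
      IsUmbilicFreeOn (𝓘(ℝ, ℝ).prod (𝓡 (d + 1))) (rotational (b := d + 2) γ) (J ×ˢ Set.univ) ∧
      (∀ s ∈ J, ∀ y : Metric.sphere (0 : EuclideanSpace ℝ (Fin (d + 2))) 1,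
        ∀ v w : ℝ × EuclideanSpace ℝ (Fin (d + 1)),
        moebiusMetric (𝓘(ℝ, ℝ).prod (𝓡 (d + 1))) (rotational (b := d + 2) γ) (s, y) v w =
          curvatureHyperbolic (Fin.last p) γ s ^ 2 * (v.1 * w.1 + sphereMetric y v.2 w.2)) ∧
      (HasConstantCurvatureOn (𝓘(ℝ, ℝ).prod (𝓡 (d + 1)))
          (moebiusMetric (𝓘(ℝ, ℝ).prod (𝓡 (d + 1))) (rotational (b := d + 2) γ))
          (J ×ˢ Set.univ) c ↔
        (0 < c ∧ IsUpToArcLength (curvatureHyperbolic (Fin.last p) γ) J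
          (fun t => 1 / (√c * Real.cosh t)) Set.univ) ∨
        (c < 0 ∧ IsUpToArcLength (curvatureHyperbolic (Fin.last p) γ) J
          (fun t => 1 / (√(-c) * Real.sinh t)) (Set.Ioi 0)) ∨
        (c = 0 ∧ IsUpToArcLength (curvatureHyperbolic (Fin.last p) γ) J
          Real.exp Set.univ))) := by
  exact ⟨fun _ hγ hκ => cylinder_geometry hd hJo hJc hJn hγ hκ,
    fun _ hγ hκ => generalizedCone_geometry hd hJo hJc hJn hγ hκ,
    fun _ hγ hκ => rotational_geometry hd hJo hJc hJn hγ hκ⟩
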